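/- A diagram of a knot is called \emph{matched} if its set of crossings can be partitioned into pairs such that the two crossings of each pair are joined by two edges of the diagram that bound a bigon face, and along this bigon two strands, which run in opposite directions, make one full twist around each other (the two crossings have the same sign, and each of the two strands passes over the other at exactly one of them). A knot in $\mathbb{R}^3$ is called \emph{bipartite} if it has a matched diagram, i.e. if some diagram of it (equivalently, some diagram related to a given one by planar isotopy and Reidemeister moves) is matched. Then none of the following knots of Rolfsen's table (Conway's notation in parentheses), in either chirality, is bipartite: $9_{35}$ ($3,3,3$), $9_{37}$ ($3,21,21$), $9_{41}$ ($20{:}20{:}20$), $9_{46}$ ($3,3,21-$, the pretzel knot with parameters $(3,3,-3)$), $9_{47}$ ($8^*{-}20$), $9_{48}$ ($21,21,21-$), $9_{49}$ ($-20{:}{-}20{:}{-}20$), $10_{74}$ ($3,3,21+$), $10_{75}$ ($21,21,21+$), $10_{103}$ ($30{:}2{:}2$), $10_{155}$ ($-3{:}2{:}2$) and $10_{157}$ ($-3{:}20{:}20$). -/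

import Mathlib

/-!
Knots are handled through their diagrams: an oriented knot diagram on the oriented sphere is
recorded by its signed Gauss word, and two diagrams represent the same knot when they are related
by a finite sequence of Reidemeister moves through such diagrams.
-/

/-- One passage of the knot through a crossing: the name of the crossing, whether the knot passes
over or under, and whether the crossing is positive (right-handed). -/
structure Pass where
  label : ℕ
  upper : Bool
  pos : Bool
  deriving DecidableEq

namespace Pass

/-- The other passage through the same crossing. -/
def flip (x : Pass) : Pass := ⟨x.label, !x.upper, x.pos⟩

/-- The same passage after all crossings have been switched. -/
def mirror (x : Pass) : Pass := ⟨x.label, !x.upper, !x.pos⟩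

/-- The same passage after a renaming of the crossings. -/
def relabel (σ : Equiv.Perm ℕ) (x : Pass) : Pass := ⟨σ x.label, x.upper, x.pos⟩

/-- Seen from the passage `x`, the other strand at this crossing runs from right to left.
(At a positive crossing the direction of the lower strand is obtained from that of the upper
strand by a counterclockwise rotation.) -/
def otherToLeft (x : Pass) : Bool := x.upper == x.pos

end Pass

/-- The cyclic successor of `x` in the word `w`. -/
def cyclicSucc (w : List Pass) (x : Pass) : Pass :=
  if h : x ∈ w then w.next x h else x

/-- `(x, true)` stands for the directed edge that leaves the passage `x` along the orientation of
the knot, `(x, false)` for the one that leaves it against the orientation. A face is traced with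
the face on the left: walk along the edge to the next passage `y`, then turn left into the other
strand of that crossing. -/
def faceStep (w : List Pass) (d : Pass × Bool) : Pass × Bool :=
  let y := if d.2 then cyclicSucc w d.1 else cyclicSucc w.reverse d.1
  (y.flip, y.otherToLeft == d.2)

/-- The directed edges of the diagram. -/
abbrev Dart (w : List Pass) : Type := {d : Pass × Bool // d.1 ∈ w}

/-- The faces: the orbits of `faceStep` on the directed edges. -/
abbrev Faces (w : List Pass) : Type :=
  Quot fun d e : Dart w => faceStep w d.1 = e.1

/-- The surface obtained by filling the faces is a sphere. With `n` crossings there are `2 n` edges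
and the length of the word is `2 n`, so Euler's formula reads `#faces = n + 2`. The empty word is
the diagram without crossings, a simple closed curve. -/
def IsSpherical (w : List Pass) : Prop :=
  w = [] ∨ 2 * Nat.card (Faces w) = w.length + 4

/-- An oriented knot diagram on the sphere: a cyclic word in which every crossing occurs exactly
twice, once over and once under, with one sign, and whose underlying surface is the sphere. -/
structure KnotDiagram where
  word : List Pass
  nodup : (word.map fun x => (x.label, x.upper)).Nodup
  closed : ∀ x ∈ word, x.flip ∈ word
  spherical : IsSpherical word

/-- Two letters in the order `x y` or `y x`. -/
def arrange (e : Bool) (x y : Pass) : List Pass := if e then [x, y] else [y, x]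

/-- The moves on Gauss words: choice of the base point, renaming of the crossings and the three
Reidemeister moves, with all orientations of the strands and all signs.

In the second move `e` says whether the two strands of the bigon are parallel.

In the third move there are an upper strand, with crossings `a`, `b`, a middle strand, with
crossings `a`, `c`, and a lower strand, with crossings `b`, `c`. The bits `e₁ e₂ e₃` say in which
order each strand meets its two crossings; the three lines bound a triangle exactly if, for one
value of `o` (the orientation of the triangle `abc`), the signs of the crossings `a`, `b`, `c` are
the products `o e₁ e₂`, `o e₁ e₃`, `o e₂ e₃`, where `true` is read as `+1` and `false` as `-1`. The
move reverses the three orders. There are two constructors for the two cyclic orders in which the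
knot can run through the three strands. -/
inductive Move : List Pass → List Pass → Prop
  | rotate (u v : List Pass) : Move (u ++ v) (v ++ u)
  | relabel (σ : Equiv.Perm ℕ) (w : List Pass) : Move w (w.map (Pass.relabel σ))
  | r1 (a : ℕ) (t s : Bool) (w : List Pass) :
      Move ([⟨a, t, s⟩, ⟨a, !t, s⟩] ++ w) w
  | r2 (a b : ℕ) (s e : Bool) (u v : List Pass) :
      Move ([⟨a, true, s⟩, ⟨b, true, !s⟩] ++ u ++ arrange e ⟨a, false, s⟩ ⟨b, false, !s⟩ ++ v)
        (u ++ v)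
  | r3 (a b c : ℕ) (o e₁ e₂ e₃ sa sb sc : Bool) (u v w : List Pass)
      (ha : sa = (o == (e₁ == e₂))) (hb : sb = (o == (e₁ == e₃))) (hc : sc = (o == (e₂ == e₃))) :
      Move
        (arrange e₁ ⟨a, true, sa⟩ ⟨b, true, sb⟩ ++ u ++ arrange e₂ ⟨a, false, sa⟩ ⟨c, true, sc⟩ ++ v
          ++ arrange e₃ ⟨b, false, sb⟩ ⟨c, false, sc⟩ ++ w)
        (arrange (!e₁) ⟨a, true, sa⟩ ⟨b, true, sb⟩ ++ u
          ++ arrange (!e₂) ⟨a, false, sa⟩ ⟨c, true, sc⟩ ++ v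
          ++ arrange (!e₃) ⟨b, false, sb⟩ ⟨c, false, sc⟩ ++ w)
  | r3' (a b c : ℕ) (o e₁ e₂ e₃ sa sb sc : Bool) (u v w : List Pass)
      (ha : sa = (o == (e₁ == e₂))) (hb : sb = (o == (e₁ == e₃))) (hc : sc = (o == (e₂ == e₃))) :
      Move
        (arrange e₁ ⟨a, true, sa⟩ ⟨b, true, sb⟩ ++ u ++ arrange e₃ ⟨b, false, sb⟩ ⟨c, false, sc⟩ ++ v
          ++ arrange e₂ ⟨a, false, sa⟩ ⟨c, true, sc⟩ ++ w)
        (arrange (!e₁) ⟨a, true, sa⟩ ⟨b, true, sb⟩ ++ u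
          ++ arrange (!e₃) ⟨b, false, sb⟩ ⟨c, false, sc⟩ ++ v
          ++ arrange (!e₂) ⟨a, false, sa⟩ ⟨c, true, sc⟩ ++ w)

/-- `y` immediately follows `x` in the cyclic word `w`. -/
def Consecutive (w : List Pass) (x y : Pass) : Prop := ∃ u, w ~r (x :: y :: u)

/-- The crossings `a` and `b` form a matched pair: two counter-directed strands make one full
twist around each other. One strand runs from `a` directly to `b`, the other from `b` directly to
`a`, the crossings have the same sign, and each strand is over at exactly one of them. -/
def MatchedPair (w : List Pass) (a b : ℕ) : Prop :=
  a ≠ b ∧ ∃ o s : Bool,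
    Consecutive w ⟨a, o, s⟩ ⟨b, !o, s⟩ ∧ Consecutive w ⟨b, o, s⟩ ⟨a, !o, s⟩

namespace KnotDiagram

/-- Two diagrams represent the same oriented knot. -/
def Equivalent : KnotDiagram → KnotDiagram → Prop :=
  Relation.EqvGen fun D E => Move D.word E.word

/-- The crossings are split into matched pairs, `m` being the involution that pairs them. -/
def IsMatched (D : KnotDiagram) : Prop :=
  ∃ m : ℕ → ℕ, ∀ x ∈ D.word, m (m x.label) = x.label ∧ MatchedPair D.word x.label (m x.label)

/-- The knot represented by `K` has a matched diagram. The orientation of the knot plays no role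
here, since a diagram stays matched when the orientation is reversed. -/
def IsBipartite (K : KnotDiagram) : Prop :=
  ∃ D : KnotDiagram, Equivalent K D ∧ D.IsMatched

end KnotDiagram

theorem Pass.mirror_injective : Function.Injective Pass.mirror := by
  rintro ⟨a, o, s⟩ ⟨b, p, t⟩ h
  simpa [Pass.mirror] using h

theorem cyclicSucc_mirror (w : List Pass) (x : Pass) :
    cyclicSucc (w.map Pass.mirror) x.mirror = (cyclicSucc w x).mirror := by
  have key : ∀ (l : List Pass) (y : Pass),
      (l.map Pass.mirror).nextOr x.mirror y.mirror = (l.nextOr x y).mirror := by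
    intro l
    induction l with
    | nil => intro y; rfl
    | cons a l ih =>
      intro y
      cases l with
      | nil => rfl
      | cons b l =>
        by_cases hxa : x = a
        · simp [List.nextOr, hxa]
        · have h' : x.mirror ≠ a.mirror := fun h => hxa (Pass.mirror_injective h)
          simpa [List.nextOr, hxa, h'] using ih y
  by_cases h : x ∈ w
  · have h' : x.mirror ∈ w.map Pass.mirror := List.mem_map_of_mem h
    rw [cyclicSucc, cyclicSucc, dif_pos h, dif_pos h', List.next, List.next]
    convert key w _ using 2
    simp
  · have h' : x.mirror ∉ w.map Pass.mirror := by
      rw [List.mem_map_of_injective Pass.mirror_injective]; exact h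
    rw [cyclicSucc, cyclicSucc, dif_neg h, dif_neg h']

theorem faceStep_mirror (w : List Pass) (d : Pass × Bool) :
    faceStep (w.map Pass.mirror) (d.1.mirror, d.2) =
      ((faceStep w d).1.mirror, (faceStep w d).2) := by
  have hl : ∀ y : Pass, y.mirror.otherToLeft = y.otherToLeft := by
    rintro ⟨a, o, s⟩; cases o <;> cases s <;> rfl
  have hf : ∀ y : Pass, y.mirror.flip = y.flip.mirror := fun _ => rfl
  obtain ⟨x, b⟩ := d
  cases b <;> simp [faceStep, ← List.map_reverse, cyclicSucc_mirror, hl, hf]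

theorem card_faces_mirror (w : List Pass) :
    Nat.card (Faces (w.map Pass.mirror)) = Nat.card (Faces w) := by
  let f : Dart w → Dart (w.map Pass.mirror) :=
    fun d => ⟨(d.1.1.mirror, d.1.2), List.mem_map_of_mem d.2⟩
  have hf : Function.Bijective f := by
    constructor
    · rintro ⟨⟨x, b⟩, hx⟩ ⟨⟨y, c⟩, hy⟩ h
      have h' := congrArg Subtype.val h
      simp only [f, Prod.mk.injEq] at h'
      obtain ⟨h1, rfl⟩ := h'
      obtain rfl := Pass.mirror_injective h1
      rfl
    · rintro ⟨⟨x, b⟩, hx⟩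
      obtain ⟨y, hy, rfl⟩ := List.mem_map.1 hx
      exact ⟨⟨(y, b), hy⟩, rfl⟩
  refine (Nat.card_congr (Quot.congr (Equiv.ofBijective f hf) ?_)).symm
  rintro ⟨⟨x, b⟩, hx⟩ ⟨⟨y, c⟩, hy⟩
  have h := faceStep_mirror w (x, b)
  simp only [Equiv.ofBijective_apply, f]
  rw [h, Prod.ext_iff, Prod.ext_iff]
  simp only [Pass.mirror_injective.eq_iff]

/-- The mirror image of a diagram: all crossings are switched. -/
def KnotDiagram.mirror (D : KnotDiagram) : KnotDiagram where
  word := D.word.map Pass.mirror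
  nodup := by
    have h := D.nodup.map (f := fun p : ℕ × Bool => (p.1, !p.2)) (by
      rintro ⟨a, b⟩ ⟨c, d⟩ h; simpa using h)
    rw [List.map_map] at h ⊢
    exact h
  closed := by
    intro x hx
    obtain ⟨y, hy, rfl⟩ := List.mem_map.1 hx
    exact List.mem_map.2 ⟨y.flip, D.closed y hy, rfl⟩
  spherical := by
    rcases D.spherical with h | h
    · exact Or.inl (by simp [h])
    · exact Or.inr (by rw [card_faces_mirror, h, List.length_map])

/-- A directed edge of least code among the first `k + 1` edges of the face that starts at `d`. -/
def faceRep (w : List Pass) : ℕ → Pass × Bool → Pass × Bool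
  | 0, d => d
  | k + 1, d =>
    let code := fun e : Pass × Bool => 4 * e.1.label + 2 * e.1.upper.toNat + e.2.toNat
    let r := faceRep w k (faceStep w d)
    if Nat.ble (code d) (code r) then d else r

/-- A list of the directed edges. -/
def dartList (w : List Pass) : List (Pass × Bool) := w.flatMap fun x => [(x, true), (x, false)]

theorem mem_dartList {w : List Pass} {d : Pass × Bool} : d ∈ dartList w ↔ d.1 ∈ w := by
  obtain ⟨x, b⟩ := d
  cases b <;> simp [dartList]

/-- Counting faces by representatives. -/
theorem isSpherical_of_faceRep (w : List Pass) (k : ℕ)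
    (h₁ : ∀ d ∈ dartList w, faceStep w d ∈ dartList w)
    (h₂ : ∀ d ∈ dartList w, faceRep w k (faceStep w d) = faceRep w k d)
    (h₃ : 2 * ((dartList w).map (faceRep w k)).dedup.length = w.length + 4) :
    IsSpherical w := by
  right
  have hrep : ∀ (j : ℕ) (d : Dart w), ∃ h : (faceRep w j d.1).1 ∈ w,
      (Quot.mk _ ⟨faceRep w j d.1, h⟩ : Faces w) = Quot.mk _ d := by
    intro j
    induction j with
    | zero => intro d; exact ⟨d.2, rfl⟩
    | succ j ih =>
      intro d
      have hs := mem_dartList.1 (h₁ d.1 (mem_dartList.2 d.2))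
      obtain ⟨hm, he⟩ := ih ⟨faceStep w d.1, hs⟩
      have hstep : (Quot.mk _ d : Faces w) = Quot.mk _ ⟨faceStep w d.1, hs⟩ := Quot.sound rfl
      have hcase : faceRep w (j + 1) d.1 = d.1 ∨
          faceRep w (j + 1) d.1 = faceRep w j (faceStep w d.1) := by
        simp only [faceRep]
        split_ifs
        · exact Or.inl rfl
        · exact Or.inr rfl
      rcases hcase with h | h
      · have h' : (⟨faceRep w (j + 1) d.1, by rw [h]; exact d.2⟩ : Dart w) = d := Subtype.ext h
        exact ⟨by rw [h]; exact d.2, congrArg _ h'⟩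
      · have h' : (⟨faceRep w (j + 1) d.1, by rw [h]; exact hm⟩ : Dart w)
            = ⟨faceRep w j (faceStep w d.1), hm⟩ := Subtype.ext h
        exact ⟨by rw [h]; exact hm, (congrArg _ h').trans (he.trans hstep.symm)⟩
  let g : Faces w → Pass × Bool := Quot.lift (fun d => faceRep w k d.1) (by
    intro d e hde
    have := h₂ d.1 (mem_dartList.2 d.2)
    rw [hde] at this
    exact this.symm)
  have hg : Function.Injective g := by
    intro p q
    induction p using Quot.ind with | _ d => ?_
    induction q using Quot.ind with | _ e => ?_
    intro h
    obtain ⟨hd, hd'⟩ := hrep k d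
    obtain ⟨he, he'⟩ := hrep k e
    rw [← hd', ← he']
    exact congrArg _ (Subtype.ext h)
  have hr : Set.range g = (((dartList w).map (faceRep w k)).toFinset : Set (Pass × Bool)) := by
    ext r
    simp only [Set.mem_range, List.coe_toFinset, List.mem_map, Set.mem_ofPred_eq]
    constructor
    · rintro ⟨p, rfl⟩
      induction p using Quot.ind with | _ d => ?_
      exact ⟨d.1, mem_dartList.2 d.2, rfl⟩
    · rintro ⟨d, hd, rfl⟩
      exact ⟨Quot.mk _ ⟨d, mem_dartList.1 hd⟩, rfl⟩
  have hc : Nat.card (Faces w) = ((dartList w).map (faceRep w k)).dedup.length := by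
    rw [← Nat.card_range_of_injective hg, hr, Nat.card_coe_set_eq, Set.ncard_coe_finset,
      List.card_toFinset]
  rw [hc, h₃]

/-- The Gauss word of a planar diagram code. The edges of the diagram are numbered `1, …, N` along
the knot, and `(i, j, k, l)` lists the edges at a crossing counterclockwise, beginning with the
incoming lower edge `i`. The crossing is positive if the upper strand runs from `l` to `j`. -/
def gaussWord (code : List (ℕ × ℕ × ℕ × ℕ)) : List Pass :=
  let N := 2 * code.length
  (List.range N).flatMap fun p => code.zipIdx.flatMap fun q =>
    let i := q.1.1
    let j := q.1.2.1
    let l := q.1.2.2.2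
    let positive := j == l % N + 1
    (if i = p + 1 then [⟨q.2, false, positive⟩] else []) ++
      (if (if positive then l else j) = p + 1 then [⟨q.2, true, positive⟩] else [])

/-- The diagram given by a planar diagram code, once the code has been checked. -/
def KnotDiagram.ofPD (code : List (ℕ × ℕ × ℕ × ℕ))
    (h : ((gaussWord code).map fun x => (x.label, x.upper)).Nodup ∧
      (∀ x ∈ gaussWord code, x.flip ∈ gaussWord code) ∧
      (∀ d ∈ dartList (gaussWord code),
        faceStep (gaussWord code) d ∈ dartList (gaussWord code)) ∧
      (∀ d ∈ dartList (gaussWord code),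
        faceRep (gaussWord code) 8 (faceStep (gaussWord code) d) =
          faceRep (gaussWord code) 8 d) ∧
      2 * ((dartList (gaussWord code)).map (faceRep (gaussWord code) 8)).dedup.length =
        (gaussWord code).length + 4) : KnotDiagram where
  word := gaussWord code
  nodup := h.1
  closed := h.2.1
  spherical := isSpherical_of_faceRep _ 8 h.2.2.1 h.2.2.2.1 h.2.2.2.2

/-- The knot `9_35` of Rolfsen's table, in Conway's notation `3,3,3`. -/
def knot9_35 : KnotDiagram :=
  KnotDiagram.ofPD [(2, 14, 3, 13), (4, 12, 5, 11), (6, 16, 7, 15), (8, 2, 9, 1), (10, 18, 11, 17),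
    (12, 4, 13, 3), (14, 8, 15, 7), (16, 6, 17, 5), (18, 10, 1, 9)]
    (by decide +kernel)

/-- The knot `9_37` of Rolfsen's table, in Conway's notation `3,21,21`. -/
def knot9_37 : KnotDiagram :=
  KnotDiagram.ofPD [(2, 11, 3, 12), (4, 2, 5, 1), (6, 14, 7, 13), (8, 17, 9, 18), (10, 3, 11, 4),
    (12, 8, 13, 7), (14, 6, 15, 5), (16, 9, 17, 10), (18, 16, 1, 15)]
    (by decide +kernel)

/-- The knot `9_41` of Rolfsen's table, in Conway's notation `20:20:20`. -/
def knot9_41 : KnotDiagram :=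
  KnotDiagram.ofPD [(2, 11, 3, 12), (4, 15, 5, 16), (6, 2, 7, 1), (8, 17, 9, 18), (10, 3, 11, 4),
    (12, 8, 13, 7), (14, 5, 15, 6), (16, 9, 17, 10), (18, 14, 1, 13)]
    (by decide +kernel)

/-- The knot `9_46` of Rolfsen's table, in Conway's notation `3,3,21-`. -/
def knot9_46 : KnotDiagram :=
  KnotDiagram.ofPD [(2, 11, 3, 12), (4, 2, 5, 1), (5, 14, 6, 15), (7, 12, 8, 13), (9, 17, 10, 16),
    (10, 3, 11, 4), (13, 6, 14, 7), (15, 18, 16, 1), (17, 9, 18, 8)]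
    (by decide +kernel)

/-- The standard diagram of the pretzel knot with parameters `(3, 3, -3)`. -/
def pretzel33neg3 : KnotDiagram :=
  KnotDiagram.ofPD [(1, 12, 2, 13), (3, 10, 4, 11), (5, 14, 6, 15), (8, 18, 9, 17), (11, 2, 12, 3),
    (13, 6, 14, 7), (15, 4, 16, 5), (16, 10, 17, 9), (18, 8, 1, 7)]
    (by decide +kernel)

/-- The knot `9_47` of Rolfsen's table, in Conway's notation `8*-20`. -/
def knot9_47 : KnotDiagram :=
  KnotDiagram.ofPD [(2, 15, 3, 16), (4, 14, 5, 13), (6, 2, 7, 1), (8, 3, 9, 4), (10, 6, 11, 5),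
    (11, 1, 12, 18), (14, 9, 15, 10), (16, 8, 17, 7), (17, 13, 18, 12)]
    (by decide +kernel)

/-- The knot `9_48` of Rolfsen's table, in Conway's notation `21,21,21-`. -/
def knot9_48 : KnotDiagram :=
  KnotDiagram.ofPD [(2, 11, 3, 12), (4, 2, 5, 1), (5, 14, 6, 15), (7, 12, 8, 13), (8, 17, 9, 18),
    (10, 3, 11, 4), (13, 6, 14, 7), (16, 9, 17, 10), (18, 16, 1, 15)]
    (by decide +kernel)

/-- The knot `9_49` of Rolfsen's table, in Conway's notation `-20:-20:-20`. -/
def knot9_49 : KnotDiagram :=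
  KnotDiagram.ofPD [(3, 11, 4, 10), (5, 15, 6, 14), (6, 2, 7, 1), (9, 17, 10, 16), (11, 3, 12, 2),
    (12, 8, 13, 7), (15, 5, 16, 4), (17, 9, 18, 8), (18, 14, 1, 13)]
    (by decide +kernel)

/-- The knot `10_74` of Rolfsen's table, in Conway's notation `3,3,21+`. -/
def knot10_74 : KnotDiagram :=
  KnotDiagram.ofPD [(2, 13, 3, 14), (4, 2, 5, 1), (6, 18, 7, 17), (8, 16, 9, 15), (10, 20, 11, 19),
    (12, 3, 13, 4), (14, 6, 15, 5), (16, 8, 17, 7), (18, 12, 19, 11), (20, 10, 1, 9)]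
    (by decide +kernel)

/-- The knot `10_75` of Rolfsen's table, in Conway's notation `21,21,21+`. -/
def knot10_75 : KnotDiagram :=
  KnotDiagram.ofPD [(1, 11, 2, 10), (3, 15, 4, 14), (5, 19, 6, 18), (7, 20, 8, 1), (9, 3, 10, 2),
    (11, 8, 12, 9), (13, 5, 14, 4), (15, 12, 16, 13), (17, 7, 18, 6), (19, 16, 20, 17)]
    (by decide +kernel)

/-- The knot `10_103` of Rolfsen's table, in Conway's notation `30:2:2`. -/
def knot10_103 : KnotDiagram :=
  KnotDiagram.ofPD [(2, 18, 3, 17), (4, 11, 5, 12), (6, 2, 7, 1), (8, 15, 9, 16), (10, 3, 11, 4),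
    (12, 19, 13, 20), (14, 9, 15, 10), (16, 7, 17, 8), (18, 6, 19, 5), (20, 13, 1, 14)]
    (by decide +kernel)

/-- The knot `10_155` of Rolfsen's table, in Conway's notation `-3:2:2`. -/
def knot10_155 : KnotDiagram :=
  KnotDiagram.ofPD [(2, 15, 3, 16), (4, 11, 5, 12), (6, 2, 7, 1), (8, 18, 9, 17), (10, 3, 11, 4),
    (13, 20, 14, 1), (14, 5, 15, 6), (16, 8, 17, 7), (18, 10, 19, 9), (19, 12, 20, 13)]
    (by decide +kernel)

/-- The knot `10_157` of Rolfsen's table, in Conway's notation `-3:20:20`. -/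
def knot10_157 : KnotDiagram :=
  KnotDiagram.ofPD [(3, 10, 4, 11), (5, 18, 6, 19), (6, 2, 7, 1), (8, 15, 9, 16), (9, 2, 10, 3),
    (11, 17, 12, 16), (12, 19, 13, 20), (14, 7, 15, 8), (17, 4, 18, 5), (20, 13, 1, 14)]
    (by decide +kernel)

/-!
A Fox colouring is a colouring by the Alexander quandle over a field `K` with `t = -1`. Every Fox
colouring of a matched diagram lifts to a colouring over the dual numbers `K[ε]` with `t = -1 + ε`:
the colours of the edges that run into the twists are the sums of the values on both sides of a
function on the faces, and a quarter of the differences of these values serves as the `ε`-parts.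
Such a function exists since, by Euler's formula, there are as many faces as conditions.

That all Fox colourings lift is invariant under the Reidemeister moves. For each knot of the list
there is a Fox colouring over a small prime field without a lift, as a linear combination of the
equations for the `ε`-parts reads `0 = c` with `c ≠ 0`. Bipartiteness is invariant under mirror
images.
-/

open scoped Quandles

/-! ### Quandle colourings -/

section Colourings

variable {Q Q' : Type*} [Quandle Q] [Quandle Q'] {π : Q →◃ Q'}

/-- The colour in which a strand of colour `x` continues after it has passed under a strand of
colour `y`, at a crossing that is positive if `s = true`. -/
def underpass (s : Bool) (y x : Q) : Q := if s then y ◃ x else y ◃⁻¹ x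

@[simp] theorem underpass_false (y x : Q) : underpass false y x = y ◃⁻¹ x := rfl

@[simp] theorem underpass_self (s : Bool) (x : Q) : underpass s x x = x := by
  cases s
  · exact Quandle.fix_inv
  · exact Quandle.fix

@[simp] theorem underpass_not_underpass (s : Bool) (y x : Q) :
    underpass (!s) y (underpass s y x) = x := by
  cases s
  · exact Rack.act_invAct_eq y x
  · exact Rack.invAct_act_eq y x

@[simp] theorem underpass_underpass_not (s : Bool) (y x : Q) :
    underpass s y (underpass (!s) y x) = x := by
  simpa using underpass_not_underpass (!s) y x

theorem eq_underpass_iff {s : Bool} {x y z : Q} :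
    z = underpass s y x ↔ x = underpass (!s) y z :=
  ⟨fun h => by simp [h], fun h => by simp [h]⟩

theorem act_underpass (t : Bool) (x y z : Q) :
    x ◃ underpass t y z = underpass t (x ◃ y) (x ◃ z) := by
  cases t
  · rw [underpass_false, underpass_false, ← Rack.left_cancel (x ◃ y), Rack.act_invAct_eq,
      ← Shelf.self_distrib, Rack.act_invAct_eq]
  · exact Shelf.self_distrib

theorem underpass_underpass (s t : Bool) (x y z : Q) :
    underpass s x (underpass t y z) = underpass t (underpass s x y) (underpass s x z) := by
  cases s
  · rw [underpass_false, ← Rack.left_cancel x, act_underpass]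
    simp only [underpass_false, Rack.act_invAct_eq]
  · exact act_underpass t x y z

theorem map_underpass (π : Q →◃ Q') (s : Bool) (y x : Q) :
    π (underpass s y x) = underpass s (π y) (π x) := by
  cases s
  · rw [underpass_false, underpass_false, ← Rack.left_cancel (π y), ← π.map_act,
      Rack.act_invAct_eq, Rack.act_invAct_eq]
  · exact π.map_act

/-- A strand of colour `x` that runs through the passages of `w` ends with the colour `y`, where
`f c` is the colour of the upper strand at the crossing `c`. A colouring of the closed word `w` is a
pair `f`, `x` with `Runs f x w x`. -/
def Runs (f : ℕ → Q) : Q → List Pass → Q → Prop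
  | x, [], y => x = y
  | x, p :: w, y =>
    if p.upper then x = f p.label ∧ Runs f x w y else Runs f (underpass p.pos (f p.label) x) w y

@[simp] theorem runs_nil {f : ℕ → Q} {x y : Q} : Runs f x [] y ↔ x = y := Iff.rfl

@[simp] theorem runs_over_cons {f : ℕ → Q} {x y : Q} {a : ℕ} {s : Bool} {w : List Pass} :
    Runs f x (⟨a, true, s⟩ :: w) y ↔ x = f a ∧ Runs f x w y := by
  simp [Runs]

@[simp] theorem runs_under_cons {f : ℕ → Q} {x y : Q} {a : ℕ} {s : Bool} {w : List Pass} :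
    Runs f x (⟨a, false, s⟩ :: w) y ↔ Runs f (underpass s (f a) x) w y := by
  simp [Runs]

theorem runs_append {f : ℕ → Q} {u v : List Pass} {x y : Q} :
    Runs f x (u ++ v) y ↔ ∃ z, Runs f x u z ∧ Runs f z v y := by
  induction u generalizing x with
  | nil => simp
  | cons p u ih => obtain ⟨a, _ | _, s⟩ := p <;> simp [ih, and_assoc]

theorem Runs.append_imp {f g : ℕ → Q} {u v u' v' : List Pass} {x y : Q}
    (h : Runs f x (u ++ v) y) (hu : ∀ z, Runs f x u z → Runs g x u' z)
    (hv : ∀ z, Runs f z v y → Runs g z v' y) : Runs g x (u' ++ v') y := by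
  obtain ⟨z, h₁, h₂⟩ := runs_append.1 h
  exact runs_append.2 ⟨z, hu z h₁, hv z h₂⟩

theorem runs_congr {f g : ℕ → Q} {w : List Pass} (h : ∀ p ∈ w, f p.label = g p.label) {x y : Q} :
    Runs f x w y ↔ Runs g x w y := by
  induction w generalizing x with
  | nil => rfl
  | cons p w ih =>
    simp only [Runs, h p List.mem_cons_self, ih fun q hq => h q (List.mem_cons_of_mem p hq)]

theorem runs_update {f : ℕ → Q} {a : ℕ} {c : Q} {w : List Pass} (h : ∀ p ∈ w, p.label ≠ a)
    {x y : Q} : Runs (Function.update f a c) x w y ↔ Runs f x w y :=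
  runs_congr fun p hp => Function.update_of_ne (h p hp) _ _

theorem runs_relabel {f : ℕ → Q} {σ : Equiv.Perm ℕ} {w : List Pass} {x y : Q} :
    Runs f x (w.map (Pass.relabel σ)) y ↔ Runs (f ∘ σ) x w y := by
  induction w generalizing x with
  | nil => rfl
  | cons p w ih => simp [Runs, Pass.relabel, ih]

theorem Runs.unique {f : ℕ → Q} {w : List Pass} {x y z : Q} (hy : Runs f x w y)
    (hz : Runs f x w z) : y = z := by
  induction w generalizing x with
  | nil => exact (runs_nil.1 hy).symm.trans (runs_nil.1 hz)
  | cons p w ih =>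
    obtain ⟨a, _ | _, s⟩ := p
    · exact ih (runs_under_cons.1 hy) (runs_under_cons.1 hz)
    · exact ih (runs_over_cons.1 hy).2 (runs_over_cons.1 hz).2

theorem Runs.map (π : Q →◃ Q') {f : ℕ → Q} {w : List Pass} {x y : Q} (h : Runs f x w y) :
    Runs (π ∘ f) (π x) w (π y) := by
  induction w generalizing x with
  | nil => exact congrArg π h
  | cons p w ih =>
    obtain ⟨a, _ | _, s⟩ := p
    · simpa [map_underpass] using ih (runs_under_cons.1 h)
    · obtain ⟨rfl, h⟩ := runs_over_cons.1 h
      exact runs_over_cons.2 ⟨rfl, ih h⟩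

/-- Every colouring of the closed word `w` by `Q'` lifts along `π` to a colouring by `Q`. -/
def Lifts (π : Q →◃ Q') (w : List Pass) : Prop :=
  ∀ (f : ℕ → Q') (x : Q'), Runs f x w x →
    ∃ (g : ℕ → Q) (y : Q), (∀ p ∈ w, π (g p.label) = f p.label) ∧ π y = x ∧ Runs g y w y

/-! ### Invariance under the Reidemeister moves -/

theorem Lifts.rotate {u v : List Pass} (h : Lifts π (u ++ v)) : Lifts π (v ++ u) := by
  intro f z hz
  obtain ⟨x, hv, hu⟩ := runs_append.1 hz
  obtain ⟨g, y, hg, rfl, hy⟩ := h f x (runs_append.2 ⟨z, hu, hv⟩)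
  obtain ⟨z', hu', hv'⟩ := runs_append.1 hy
  refine ⟨g, z', fun p hp => hg p (List.perm_append_comm.mem_iff.1 hp), ?_,
    runs_append.2 ⟨y, hv', hu'⟩⟩
  exact (hu'.map π).unique
    ((runs_congr fun p hp => hg p (List.mem_append_left v hp)).2 hu)

theorem Lifts.relabel {w : List Pass} (σ : Equiv.Perm ℕ) (h : Lifts π w) :
    Lifts π (w.map (Pass.relabel σ)) := by
  intro f x hx
  obtain ⟨g, y, hg, hy, hr⟩ := h _ x (runs_relabel.1 hx)
  refine ⟨g ∘ σ.symm, y, List.forall_mem_map.2 fun p hp => ?_, hy, runs_relabel.2 ?_⟩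
  · simpa [Pass.relabel] using hg p hp
  · simpa [Function.comp_assoc] using hr

theorem lifts_relabel_iff {w : List Pass} (σ : Equiv.Perm ℕ) :
    Lifts π (w.map (Pass.relabel σ)) ↔ Lifts π w := by
  refine ⟨fun h => ?_, Lifts.relabel σ⟩
  simpa [Function.comp_def, Pass.relabel] using h.relabel σ.symm

theorem Lifts.of_recolouring {w w' : List Pass} (h : Lifts π w)
    (down : (ℕ → Q') → Q' → ℕ → Q') (up : (ℕ → Q) → Q → ℕ → Q)
    (hdown : ∀ f x, Runs f x w' x → Runs (down f x) x w x)
    (hup : ∀ g y, Runs g y w y → Runs (up g y) y w' y)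
    (hπ : ∀ f g y, Runs f (π y) w' (π y) → (∀ p ∈ w, π (g p.label) = down f (π y) p.label) →
      ∀ p ∈ w', π (up g y p.label) = f p.label) :
    Lifts π w' := by
  intro f x hx
  obtain ⟨g, y, hg, rfl, hr⟩ := h _ _ (hdown f x hx)
  exact ⟨up g y, y, hπ f g y hx hg, rfl, hup g y hr⟩

/-- No passage occurs twice in the word; the sign of the crossing does not distinguish passages. -/
def DistinctPasses (w : List Pass) : Prop := (w.map fun x => (x.label, x.upper)).Nodup

theorem DistinctPasses.perm {w w' : List Pass} (hw : DistinctPasses w) (h : w.Perm w') :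
    DistinctPasses w' :=
  (h.map _).nodup_iff.1 hw

theorem DistinctPasses.label_ne {l u : List Pass} (h : DistinctPasses (l ++ u)) {a : ℕ}
    (ha : ∀ o, (a, o) ∈ l.map fun x => (x.label, x.upper)) : ∀ p ∈ u, p.label ≠ a := by
  rintro p hp rfl
  rw [DistinctPasses, List.map_append] at h
  exact List.disjoint_of_nodup_append h (ha p.upper) (List.mem_map_of_mem hp)

theorem runs_kink_append {f : ℕ → Q} {a : ℕ} {t s : Bool} {w : List Pass} {x y : Q} :
    Runs f x ([⟨a, t, s⟩, ⟨a, !t, s⟩] ++ w) y ↔ f a = x ∧ Runs f x w y := by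
  have hfix : underpass s (f a) x = f a ↔ f a = x := by
    rw [eq_comm, eq_underpass_iff, underpass_self, eq_comm]
  cases t
  · simp only [Bool.not_false, List.cons_append, List.nil_append, runs_under_cons,
      runs_over_cons, hfix]
    refine and_congr_right ?_
    rintro rfl
    rw [underpass_self]
  · simp only [Bool.not_true, List.cons_append, List.nil_append, runs_under_cons,
      runs_over_cons, eq_comm (a := x)]
    refine and_congr_right ?_
    rintro rfl
    rw [underpass_self]

theorem lifts_kink_iff {a : ℕ} {t s : Bool} {w : List Pass}
    (hw : DistinctPasses ([⟨a, t, s⟩, ⟨a, !t, s⟩] ++ w)) :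
    Lifts π ([⟨a, t, s⟩, ⟨a, !t, s⟩] ++ w) ↔ Lifts π w := by
  have ha : ∀ p ∈ w, p.label ≠ a := hw.label_ne (by cases t <;> simp)
  constructor <;> intro h
  · refine h.of_recolouring (fun f x => Function.update f a x) (fun g _ => g) ?_ ?_ ?_
    · exact fun f x hx => runs_kink_append.2 ⟨by simp, (runs_update ha).2 hx⟩
    · exact fun g y hy => (runs_kink_append.1 hy).2
    · intro f g y _ hg p hp
      rw [hg p (List.mem_append_right _ hp), Function.update_of_ne (ha p hp)]
  · refine h.of_recolouring (fun f _ => f) (fun g y => Function.update g a y) ?_ ?_ ?_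
    · exact fun f x hx => (runs_kink_append.1 hx).2
    · exact fun g y hy => runs_kink_append.2 ⟨by simp, (runs_update ha).2 hy⟩
    · intro f g y hf hg p hp
      by_cases hpa : p.label = a
      · rw [hpa, Function.update_self, (runs_kink_append.1 hf).1]
      · rw [Function.update_of_ne hpa]
        refine hg p ((List.mem_append.1 hp).resolve_left fun hp => hpa ?_)
        rcases List.mem_pair.1 hp with rfl | rfl <;> rfl

theorem arrange_perm (e : Bool) (x y : Pass) : (arrange e x y).Perm [x, y] := by
  cases e
  · exact List.Perm.swap _ _ _
  · exact List.Perm.refl _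

theorem runs_parallel_under_append {f : ℕ → Q} {a b : ℕ} {s e : Bool} (hab : f a = f b)
    {v : List Pass} {x y : Q} :
    Runs f x (arrange e ⟨a, false, s⟩ ⟨b, false, !s⟩ ++ v) y ↔ Runs f x v y := by
  cases e <;> simp [arrange, hab]

theorem runs_clasp_append {f : ℕ → Q} {a b : ℕ} {s e : Bool} {u v : List Pass} {x y : Q} :
    Runs f x ([⟨a, true, s⟩, ⟨b, true, !s⟩] ++ u
      ++ arrange e ⟨a, false, s⟩ ⟨b, false, !s⟩ ++ v) y ↔
      f a = x ∧ f b = x ∧ Runs f x (u ++ v) y := by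
  simp only [List.append_assoc, List.cons_append, List.nil_append, runs_over_cons,
    eq_comm (a := x)]
  refine and_congr_right fun ha => and_congr_right fun hb => ?_
  rw [runs_append, runs_append]
  simp only [runs_parallel_under_append (ha.trans hb.symm)]

theorem lifts_clasp_iff {a b : ℕ} {s e : Bool} {u v : List Pass}
    (hw : DistinctPasses ([⟨a, true, s⟩, ⟨b, true, !s⟩] ++ u
      ++ arrange e ⟨a, false, s⟩ ⟨b, false, !s⟩ ++ v)) :
    Lifts π ([⟨a, true, s⟩, ⟨b, true, !s⟩] ++ u ++ arrange e ⟨a, false, s⟩ ⟨b, false, !s⟩ ++ v) ↔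
      Lifts π (u ++ v) := by
  have hperm : ([(⟨a, true, s⟩ : Pass), ⟨b, true, !s⟩] ++ u
      ++ arrange e ⟨a, false, s⟩ ⟨b, false, !s⟩ ++ v).Perm
      ([⟨a, true, s⟩, ⟨b, true, !s⟩, ⟨a, false, s⟩, ⟨b, false, !s⟩] ++ (u ++ v)) := by
    rw [List.perm_iff_count]
    intro p
    simp only [List.count_append, (arrange_perm _ _ _).count_eq, List.count_cons, List.count_nil]
    omega
  have ha : ∀ p ∈ u ++ v, p.label ≠ a := (hw.perm hperm).label_ne (by simp)
  have hb : ∀ p ∈ u ++ v, p.label ≠ b := (hw.perm hperm).label_ne (by simp)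
  constructor <;> intro h
  · refine h.of_recolouring (fun f x => Function.update (Function.update f a x) b x)
      (fun g _ => g) ?_ ?_ ?_
    · exact fun f x hx => runs_clasp_append.2 ⟨by simp [Function.update_apply], by simp,
        (runs_update hb).2 ((runs_update ha).2 hx)⟩
    · exact fun g y hy => (runs_clasp_append.1 hy).2.2
    · intro f g y _ hg p hp
      rw [hg p (hperm.mem_iff.2 (List.mem_append_right _ hp)), Function.update_of_ne (hb p hp),
        Function.update_of_ne (ha p hp)]
  · refine h.of_recolouring (fun f _ => f)
      (fun g y => Function.update (Function.update g a y) b y) ?_ ?_ ?_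
    · exact fun f x hx => (runs_clasp_append.1 hx).2.2
    · exact fun g y hy => runs_clasp_append.2 ⟨by simp [Function.update_apply], by simp,
        (runs_update hb).2 ((runs_update ha).2 hy)⟩
    · intro f g y hf hg p hp
      obtain ⟨hfa, hfb, -⟩ := runs_clasp_append.1 hf
      by_cases hpb : p.label = b
      · rw [hpb, Function.update_self, hfb]
      by_cases hpa : p.label = a
      · rw [hpa, Function.update_of_ne (hpa ▸ hpb), Function.update_self, hfa]
      rw [Function.update_of_ne hpb, Function.update_of_ne hpa]
      refine hg p ((List.mem_append.1 (hperm.mem_iff.1 hp)).resolve_left fun hp => ?_)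
      simp only [List.mem_cons, List.not_mem_nil, or_false] at hp
      rcases hp with rfl | rfl | rfl | rfl <;> contradiction

/-- The colours after the third Reidemeister move: the upper strand at `a` slides over the crossing
`c` of the other two strands, and only the colour of the upper strand at `c` changes. -/
def slide (a c : ℕ) (s : Bool) (f : ℕ → Q) : ℕ → Q :=
  Function.update f c (underpass s (f a) (f c))

theorem slide_self (a c : ℕ) (s : Bool) (f : ℕ → Q) : slide a c s f c = underpass s (f a) (f c) :=
  Function.update_self ..

theorem slide_of_ne {a c d : ℕ} (h : d ≠ c) (s : Bool) (f : ℕ → Q) : slide a c s f d = f d :=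
  Function.update_of_ne h ..

theorem Lifts.of_slide {w w' : List Pass} {a c : ℕ} {s : Bool} (hac : a ≠ c)
    (ha : ∃ p ∈ w, p.label = a) (hc : ∃ p ∈ w, p.label = c) (hperm : w.Perm w')
    (hdown : ∀ (f : ℕ → Q') x, Runs f x w' x → Runs (slide a c (!s) f) x w x)
    (hup : ∀ (g : ℕ → Q) y, Runs g y w y → Runs (slide a c s g) y w' y)
    (h : Lifts π w) : Lifts π w' := by
  refine h.of_recolouring (fun f _ => slide a c (!s) f) (fun g _ => slide a c s g) hdown hup ?_
  intro f g y _ hg p hp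
  by_cases hpc : p.label = c
  · have hga : π (g a) = f a := by
      obtain ⟨q, hq, rfl⟩ := ha
      rw [hg q hq, slide_of_ne hac]
    have hgc : π (g c) = underpass (!s) (f a) (f c) := by
      obtain ⟨q, hq, rfl⟩ := hc
      rw [hg q hq, slide_self]
    rw [hpc, slide_self, map_underpass, hga, hgc, underpass_underpass_not]
  · rw [slide_of_ne hpc, hg p (hperm.mem_iff.2 hp), slide_of_ne hpc]

theorem runs_over_over {f : ℕ → Q} {a b : ℕ} {sa sb e : Bool} {x y : Q} :
    Runs f x (arrange e ⟨a, true, sa⟩ ⟨b, true, sb⟩) y ↔ f a = x ∧ f b = x ∧ x = y := by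
  cases e <;> simp [arrange, eq_comm (a := x), and_left_comm]

theorem runs_slide_upper {f : ℕ → Q} {a b c : ℕ} {s sa sb e : Bool} (hac : a ≠ c) (hbc : b ≠ c)
    {x y : Q} (h : Runs f x (arrange e ⟨a, true, sa⟩ ⟨b, true, sb⟩) y) :
    Runs (slide a c s f) x (arrange (!e) ⟨a, true, sa⟩ ⟨b, true, sb⟩) y := by
  rw [runs_over_over] at h ⊢
  rwa [slide_of_ne hac, slide_of_ne hbc]

theorem runs_slide_middle {f : ℕ → Q} {a c : ℕ} {s sa sc e : Bool} (hac : a ≠ c)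
    (hs : s = (sa ^^ e)) {x y : Q} (h : Runs f x (arrange e ⟨a, false, sa⟩ ⟨c, true, sc⟩) y) :
    Runs (slide a c s f) x (arrange (!e) ⟨a, false, sa⟩ ⟨c, true, sc⟩) y := by
  cases e
  · simp only [arrange, Bool.false_eq_true, if_false, runs_over_cons, runs_under_cons,
      runs_nil] at h
    obtain ⟨rfl, rfl⟩ := h
    simp [arrange, hs, slide_self, slide_of_ne hac]
  · simp only [arrange, if_true, runs_over_cons, runs_under_cons, runs_nil] at h
    obtain ⟨h, rfl⟩ := h
    simp [arrange, hs, slide_self, slide_of_ne hac, ← h]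

theorem runs_slide_lower {f : ℕ → Q} {a b c : ℕ} {s sb sc e : Bool} (hbc : b ≠ c)
    (hab : f a = f b) (hs : s = (sb ^^ e)) {x y : Q}
    (h : Runs f x (arrange e ⟨b, false, sb⟩ ⟨c, false, sc⟩) y) :
    Runs (slide a c s f) x (arrange (!e) ⟨b, false, sb⟩ ⟨c, false, sc⟩) y := by
  cases e
  · simp only [arrange, Bool.false_eq_true, if_false, runs_under_cons, runs_nil] at h
    simp [arrange, hs, slide_self, slide_of_ne hbc, hab, ← h, underpass_underpass sb sc]
  · simp only [arrange, if_true, runs_under_cons, runs_nil] at h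
    simp [arrange, hs, slide_self, slide_of_ne hbc, hab, ← h, underpass_underpass _ sc]

/-- The word of a diagram around a triangle with vertices `a`, `b`, `c`, as in the third
Reidemeister move; `k` says whether the knot runs through the middle strand before the lower one. -/
def triangleWord (k : Bool) (a b c : ℕ) (sa sb sc e₁ e₂ e₃ : Bool) (u v w : List Pass) :
    List Pass :=
  let upper := arrange e₁ ⟨a, true, sa⟩ ⟨b, true, sb⟩
  let middle := arrange e₂ ⟨a, false, sa⟩ ⟨c, true, sc⟩
  let lower := arrange e₃ ⟨b, false, sb⟩ ⟨c, false, sc⟩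
  upper ++ u ++ cond k middle lower ++ v ++ cond k lower middle ++ w

theorem triangleWord_perm (k : Bool) (a b c : ℕ) (sa sb sc e₁ e₂ e₃ : Bool) (u v w : List Pass) :
    (triangleWord k a b c sa sb sc e₁ e₂ e₃ u v w).Perm
      ([⟨a, true, sa⟩, ⟨b, true, sb⟩, ⟨a, false, sa⟩, ⟨c, true, sc⟩, ⟨b, false, sb⟩,
        ⟨c, false, sc⟩] ++ (u ++ v ++ w)) := by
  rw [List.perm_iff_count]
  intro p
  cases k <;>
  · simp only [triangleWord, cond_true, cond_false, List.count_append,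
      (arrange_perm _ _ _).count_eq, List.count_cons, List.count_nil]
    omega

theorem Runs.slide_triangle {f : ℕ → Q} {k : Bool} {a b c : ℕ} {s sa sb sc e₁ e₂ e₃ : Bool}
    {u v w : List Pass} {x y : Q} (hac : a ≠ c) (hbc : b ≠ c)
    (hfresh : ∀ p ∈ u ++ v ++ w, p.label ≠ c) (hs₂ : s = (sa ^^ e₂)) (hs₃ : s = (sb ^^ e₃))
    (h : Runs f x (triangleWord k a b c sa sb sc e₁ e₂ e₃ u v w) y) :
    Runs (slide a c s f) x (triangleWord k a b c sa sb sc (!e₁) (!e₂) (!e₃) u v w) y := by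
  simp only [List.forall_mem_append] at hfresh
  obtain ⟨⟨hu, hv⟩, hw⟩ := hfresh
  simp only [triangleWord, List.append_assoc] at h ⊢
  have hab : f a = f b := by
    obtain ⟨z, h₁, -⟩ := runs_append.1 h
    obtain ⟨ha, hb, -⟩ := runs_over_over.1 h₁
    exact ha.trans hb.symm
  refine h.append_imp (fun _ => runs_slide_upper hac hbc) fun _ h => ?_
  refine h.append_imp (fun _ => (runs_update hu).2) fun _ h => ?_
  cases k
  · refine h.append_imp (fun _ => runs_slide_lower hbc hab hs₃) fun _ h => ?_
    refine h.append_imp (fun _ => (runs_update hv).2) fun _ h => ?_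
    exact h.append_imp (fun _ => runs_slide_middle hac hs₂) fun _ => (runs_update hw).2
  · refine h.append_imp (fun _ => runs_slide_middle hac hs₂) fun _ h => ?_
    refine h.append_imp (fun _ => (runs_update hv).2) fun _ h => ?_
    exact h.append_imp (fun _ => runs_slide_lower hbc hab hs₃) fun _ => (runs_update hw).2

theorem DistinctPasses.triangle_fresh {a b c : ℕ} {sa sb sc : Bool} {w : List Pass}
    (h : DistinctPasses ([⟨a, true, sa⟩, ⟨b, true, sb⟩, ⟨a, false, sa⟩, ⟨c, true, sc⟩,
      ⟨b, false, sb⟩, ⟨c, false, sc⟩] ++ w)) :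
    a ≠ c ∧ b ≠ c ∧ ∀ p ∈ w, p.label ≠ c := by
  refine ⟨?_, ?_, h.label_ne (by simp)⟩ <;> rintro rfl <;> simp [DistinctPasses] at h

theorem lifts_triangleWord_iff {k : Bool} {a b c : ℕ} {o sa sb sc e₁ e₂ e₃ : Bool}
    {u v w : List Pass} (hsa : sa = (o == (e₁ == e₂))) (hsb : sb = (o == (e₁ == e₃)))
    (hd : DistinctPasses (triangleWord k a b c sa sb sc e₁ e₂ e₃ u v w)) :
    Lifts π (triangleWord k a b c sa sb sc e₁ e₂ e₃ u v w) ↔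
      Lifts π (triangleWord k a b c sa sb sc (!e₁) (!e₂) (!e₃) u v w) := by
  have hperm := triangleWord_perm k a b c sa sb sc
  obtain ⟨hac, hbc, hfresh⟩ := (hd.perm (hperm ..)).triangle_fresh
  have ha (e₁ e₂ e₃) : ∃ p ∈ triangleWord k a b c sa sb sc e₁ e₂ e₃ u v w, p.label = a :=
    ⟨⟨a, true, sa⟩, (hperm ..).mem_iff.2 (by simp), rfl⟩
  have hc (e₁ e₂ e₃) : ∃ p ∈ triangleWord k a b c sa sb sc e₁ e₂ e₃ u v w, p.label = c :=
    ⟨⟨c, true, sc⟩, (hperm ..).mem_iff.2 (by simp), rfl⟩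
  have hs : (sa ^^ e₂) = (sb ^^ e₃) := by
    subst hsa hsb
    cases o <;> cases e₁ <;> cases e₂ <;> cases e₃ <;> rfl
  have hs' : (sa ^^ !e₂) = (sb ^^ !e₃) := by rw [Bool.xor_not, Bool.xor_not, hs]
  constructor
  · refine Lifts.of_slide (s := sa ^^ e₂) hac (ha ..) (hc ..)
      ((hperm ..).trans (hperm ..).symm) (fun f x hf => ?_)
      fun g y => Runs.slide_triangle hac hbc hfresh rfl hs
    simpa using hf.slide_triangle hac hbc hfresh rfl hs'
  · refine Lifts.of_slide (s := sa ^^ !e₂) hac (ha ..) (hc ..)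
      ((hperm ..).trans (hperm ..).symm) (fun f x hf => ?_) fun g y hg => ?_
    · simpa using hf.slide_triangle hac hbc hfresh rfl hs
    · simpa using hg.slide_triangle hac hbc hfresh rfl hs'

theorem Move.lifts_iff {w w' : List Pass} (h : Move w w') (hw : DistinctPasses w) :
    Lifts π w ↔ Lifts π w' := by
  cases h with
  | rotate u v => exact ⟨Lifts.rotate, Lifts.rotate⟩
  | relabel σ => exact (lifts_relabel_iff σ).symm
  | r1 a t s => exact lifts_kink_iff hw
  | r2 a b s e u v => exact lifts_clasp_iff hw
  | r3 a b c o e₁ e₂ e₃ sa sb sc u v w hsa hsb _ =>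
    exact lifts_triangleWord_iff (k := true) hsa hsb hw
  | r3' a b c o e₁ e₂ e₃ sa sb sc u v w hsa hsb _ =>
    exact lifts_triangleWord_iff (k := false) hsa hsb hw

theorem KnotDiagram.Equivalent.lifts_iff {D E : KnotDiagram} (h : D.Equivalent E) :
    Lifts π D.word ↔ Lifts π E.word := by
  induction h with
  | rel D E h => exact h.lifts_iff D.nodup
  | refl => rfl
  | symm _ _ _ ih => exact ih.symm
  | trans _ _ _ _ _ ih₁ ih₂ => exact ih₁.trans ih₂

end Colourings

/-! ### Alexander quandles -/

section AlexanderQuandle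

variable {R S : Type*} [CommRing R] [CommRing S]

/-- The ring `R` with the quandle operation `x ◃ y = (1 - t) * x + t * y` of the Alexander module.
Its colourings with `t = -1` are the colourings of Fox. -/
@[nolint unusedArguments]
def AlexanderQuandle (_t : Rˣ) : Type _ := R

namespace AlexanderQuandle

/-- The operation of the Alexander quandle, for an arbitrary element `t` of the ring. -/
def act (t x y : R) : R := (1 - t) * x + t * y

theorem act_self (t x : R) : act t x x = x := by
  simp only [act]
  ring

theorem act_act_left (t u x y : R) : act t x (act u x y) = act (t * u) x y := by
  simp only [act]
  ring

theorem act_act_distrib (t x y z : R) :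
    act t x (act t y z) = act t (act t x y) (act t x z) := by
  simp only [act]
  ring

theorem act_one (x y : R) : act 1 x y = y := by simp [act]

theorem map_act (φ : R →+* S) (t x y : R) : φ (act t x y) = act (φ t) (φ x) (φ y) := by
  simp [act]

variable {t : Rˣ} {s : Sˣ}

instance [DecidableEq R] : DecidableEq (AlexanderQuandle t) := inferInstanceAs (DecidableEq R)

instance : Quandle (AlexanderQuandle t) where
  act := act (R := R) t
  invAct := act (R := R) ↑t⁻¹
  self_distrib := act_act_distrib (R := R) _ _ _ _
  left_inv := fun x y : R => by
    change act _ x (act _ x y) = y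
    rw [act_act_left, t.inv_mul, act_one]
  right_inv := fun x y : R => by
    change act _ x (act _ x y) = y
    rw [act_act_left, t.mul_inv, act_one]
  fix := act_self (R := R) _ _

theorem underpass_eq (b : Bool) (y x : AlexanderQuandle t) :
    underpass b y x = act (R := R) (if b then t else t⁻¹ : Rˣ) y x := by
  cases b <;> rfl

/-- A ring homomorphism that sends `t` to `s` is a homomorphism of Alexander quandles. -/
def map (φ : R →+* S) (h : φ t = s) : AlexanderQuandle t →◃ AlexanderQuandle s where
  toFun := φ
  map_act' {x y} := (map_act φ t x y).trans (congrArg (fun r => act r (φ x) (φ y)) h)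

end AlexanderQuandle

end AlexanderQuandle

/-! ### Cyclic words -/

section CyclicWord

variable {w : List Pass}

theorem cyclicSucc_eq_formPerm (hw : w.Nodup) (x : Pass) : cyclicSucc w x = w.formPerm x := by
  by_cases hx : x ∈ w
  · rw [cyclicSucc, dif_pos hx]
    obtain ⟨i, hi, rfl⟩ := List.getElem_of_mem hx
    rw [List.next_getElem w hw, List.formPerm_apply_getElem w hw]
  · rw [cyclicSucc, dif_neg hx, List.formPerm_apply_of_notMem hx]

theorem cyclicSucc_reverse_eq_formPerm_symm (hw : w.Nodup) (x : Pass) :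
    cyclicSucc w.reverse x = w.formPerm.symm x := by
  rw [cyclicSucc_eq_formPerm (List.nodup_reverse.2 hw), List.formPerm_reverse, Equiv.Perm.inv_def]

theorem formPerm_symm_mem_iff_mem {x : Pass} : w.formPerm.symm x ∈ w ↔ x ∈ w := by
  rw [← List.formPerm_mem_iff_mem, Equiv.apply_symm_apply]

theorem Consecutive.mem_left {x y : Pass} (h : Consecutive w x y) : x ∈ w := by
  obtain ⟨u, hu⟩ := h
  simp [hu.mem_iff]

theorem Consecutive.formPerm_apply {x y : Pass} (hw : w.Nodup) (h : Consecutive w x y) :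
    w.formPerm x = y := by
  obtain ⟨u, hu⟩ := h
  rw [List.formPerm_eq_of_isRotated hw hu]
  exact List.formPerm_apply_head x y u (hu.nodup_iff.1 hw)

theorem cyclic_induction (hw : w.Nodup) {C : Pass → Prop} {x₀ : Pass} (h₀ : x₀ ∈ w) (hC : C x₀)
    (hS : ∀ x ∈ w, C x → C (w.formPerm x)) {x : Pass} (hx : x ∈ w) : C x := by
  obtain ⟨n, rfl⟩ : ∃ n : ℕ, (w.formPerm ^ n) x₀ = x :=
    hw.isCycleOn_formPerm.exists_pow_eq' (List.finite_toSet w) h₀ hx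
  have key : ∀ n : ℕ, (w.formPerm ^ n) x₀ ∈ w ∧ C ((w.formPerm ^ n) x₀) := by
    intro n
    induction n with
    | zero => exact ⟨h₀, hC⟩
    | succ n ih =>
      rw [pow_succ', Equiv.Perm.mul_apply]
      exact ⟨List.formPerm_apply_mem_of_mem ih.1, hS _ ih.1 ih.2⟩
  exact (key n).2

variable {Q Q' : Type*} [Quandle Q] [Quandle Q'] {π : Q →◃ Q'}

/-- The edges of the closed word `w` are coloured: `h p` is the colour of the edge that runs into
`p`, and `f c` is the colour of the upper strand at the crossing `c`. -/
def IsEdgeColouring (w : List Pass) (f : ℕ → Q) (h : Pass → Q) : Prop :=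
  ∀ p ∈ w, Runs f (h p) [p] (h (w.formPerm p))

theorem runs_iff_exists_states {f : ℕ → Q} {x y : Q} :
    Runs f x w y ↔ ∃ h : ℕ → Q, h 0 = x ∧ h w.length = y ∧
      ∀ i (hi : i < w.length), Runs f (h i) [w[i]] (h (i + 1)) := by
  induction w generalizing x with
  | nil => exact ⟨fun h => ⟨fun _ => x, rfl, h, by simp⟩, fun ⟨h, h₀, h₁, _⟩ => h₀.symm.trans h₁⟩
  | cons q w ih =>
    rw [← List.singleton_append, runs_append]
    constructor
    · rintro ⟨z, hz, hr⟩
      obtain ⟨h, rfl, rfl, hh⟩ := ih.1 hr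
      refine ⟨fun i => Nat.casesOn i x h, rfl, by simp, ?_⟩
      rintro (_ | i) hi
      · simpa using hz
      · simpa using hh i (by simpa using hi)
    · rintro ⟨h, rfl, rfl, hh⟩
      refine ⟨h 1, by simpa using hh 0 (by simp), ih.2 ⟨fun i => h (i + 1), rfl, by simp, ?_⟩⟩
      intro i hi
      simpa using hh (i + 1) (by simpa using hi)

theorem runs_iff_exists_edgeColouring {p : Pass} {v : List Pass} (hw : (p :: v).Nodup)
    {f : ℕ → Q} {x : Q} :
    Runs f x (p :: v) x ↔ ∃ h, h p = x ∧ IsEdgeColouring (p :: v) f h := by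
  set w := p :: v
  have hpos : 0 < w.length := by simp [w]
  rw [runs_iff_exists_states]
  constructor
  · rintro ⟨g, hg₀, hg₁, hg⟩
    have hidx : ∀ i (hi : i < w.length), w.idxOf w[i] = i := fun i hi => hw.idxOf_getElem i hi
    refine ⟨fun q => g (w.idxOf q), by simp [w, hg₀], fun q hq => ?_⟩
    obtain ⟨i, hi, rfl⟩ := List.getElem_of_mem hq
    simp only [List.formPerm_apply_getElem w hw, hidx]
    convert hg i hi using 1
    rcases Nat.lt_or_ge (i + 1) w.length with hlt | hge
    · rw [Nat.mod_eq_of_lt hlt]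
    · rw [show i + 1 = w.length by omega, Nat.mod_self, hg₀, hg₁]
  · rintro ⟨h, rfl, hh⟩
    refine ⟨fun i => h (w[i % w.length]'(Nat.mod_lt _ hpos)), by simp [w], by simp [w], ?_⟩
    intro i hi
    simpa [List.formPerm_apply_getElem w hw, Nat.mod_eq_of_lt hi] using hh _ (List.getElem_mem hi)

theorem Lifts.of_edgeColouring (hw : w.Nodup) (hπ : Function.Surjective π)
    (H : ∀ f h, IsEdgeColouring w f h → ∃ g k, IsEdgeColouring w g k ∧
      (∀ p ∈ w, π (g p.label) = f p.label) ∧ ∀ p ∈ w, π (k p) = h p) : Lifts π w := by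
  intro f x hx
  cases w with
  | nil =>
    obtain ⟨y, rfl⟩ := hπ x
    exact ⟨fun _ => y, y, by simp, rfl, rfl⟩
  | cons p v =>
    obtain ⟨h, rfl, hh⟩ := (runs_iff_exists_edgeColouring hw).1 hx
    obtain ⟨g, k, hk, hg, hkh⟩ := H f h hh
    exact ⟨g, k p, hg, hkh p List.mem_cons_self, (runs_iff_exists_edgeColouring hw).2 ⟨k, rfl, hk⟩⟩

end CyclicWord

/-! ### Matched diagrams -/

namespace KnotDiagram

theorem nodup_word (D : KnotDiagram) : D.word.Nodup := D.nodup.of_map _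

theorem eq_of_mem (D : KnotDiagram) {x y : Pass} (hx : x ∈ D.word) (hy : y ∈ D.word)
    (hl : x.label = y.label) (hu : x.upper = y.upper) : x = y :=
  List.inj_on_of_nodup_map D.nodup hx hy (by rw [hl, hu])

/-- The set of the names of the crossings. -/
def crossings (D : KnotDiagram) : Finset ℕ := (D.word.map Pass.label).toFinset

theorem mem_crossings {D : KnotDiagram} {a : ℕ} : a ∈ D.crossings ↔ ∃ x ∈ D.word, x.label = a := by
  simp [crossings]

theorem label_mem {D : KnotDiagram} {x : Pass} (hx : x ∈ D.word) : x.label ∈ D.crossings :=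
  mem_crossings.2 ⟨x, hx, rfl⟩

theorem length_word (D : KnotDiagram) : D.word.length = 2 * D.crossings.card := by
  have h : (D.word.map fun x => (x.label, x.upper)).toFinset = D.crossings ×ˢ Finset.univ := by
    ext ⟨a, u⟩
    simp only [List.mem_toFinset, List.mem_map, Finset.mem_product, Finset.mem_univ, and_true,
      mem_crossings, Prod.mk.injEq]
    refine ⟨fun ⟨x, hx, h, _⟩ => ⟨x, hx, h⟩, ?_⟩
    rintro ⟨x, hx, rfl⟩
    by_cases hu : x.upper = u
    · exact ⟨x, hx, rfl, hu⟩
    · exact ⟨x.flip, D.closed x hx, rfl, Bool.not_eq.2 hu⟩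
  have hcard := List.toFinset_card_of_nodup D.nodup
  rw [h, Finset.card_product, List.length_map] at hcard
  simpa [mul_comm] using hcard.symm

end KnotDiagram

open KnotDiagram

/-- A division of the crossings into full twists of two counter-directed strands: `mate` exchanges
the two crossings of a twist, `pos a` says whether the crossing `a` is positive, and of the two
passages through `a` the one with `upper = enterUpper a` enters the twist while the other one leaves
it. -/
structure TwistPairing (D : KnotDiagram) where
  mate : ℕ → ℕ
  enterUpper : ℕ → Bool
  pos : ℕ → Bool
  mate_mate' : ∀ a ∈ D.crossings, mate (mate a) = a
  enterUpper_mate' : ∀ a ∈ D.crossings, enterUpper (mate a) = enterUpper a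
  pos_mate' : ∀ a ∈ D.crossings, pos (mate a) = pos a
  enter_mem' : ∀ a ∈ D.crossings, ⟨a, enterUpper a, pos a⟩ ∈ D.word
  succ_enter' : ∀ a ∈ D.crossings,
    D.word.formPerm ⟨a, enterUpper a, pos a⟩ = ⟨mate a, !enterUpper a, pos a⟩

theorem KnotDiagram.IsMatched.exists_twistPairing {D : KnotDiagram} (hD : D.IsMatched) :
    Nonempty (TwistPairing D) := by
  obtain ⟨m, hm⟩ := hD
  let IsTwist (a : ℕ) (t : Bool × Bool) : Prop :=
    Consecutive D.word ⟨a, t.1, t.2⟩ ⟨m a, !t.1, t.2⟩ ∧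
      Consecutive D.word ⟨m a, t.1, t.2⟩ ⟨a, !t.1, t.2⟩
  let type (a : ℕ) : Bool × Bool := Classical.epsilon (IsTwist a)
  have mate_mate : ∀ a ∈ D.crossings, m (m a) = a := by
    rintro _ ha
    obtain ⟨x, hx, rfl⟩ := mem_crossings.1 ha
    exact (hm x hx).1
  have type_mate : ∀ a ∈ D.crossings, type (m a) = type a := fun a ha => by
    simp only [type, IsTwist, mate_mate a ha, and_comm]
  have isTwist : ∀ a ∈ D.crossings, IsTwist a (type a) := by
    rintro _ ha
    obtain ⟨x, hx, rfl⟩ := mem_crossings.1 ha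
    obtain ⟨-, o, s, h⟩ := (hm x hx).2
    exact Classical.epsilon_spec ⟨(o, s), h⟩
  exact ⟨{
    mate := m
    enterUpper := fun a => (type a).1
    pos := fun a => (type a).2
    mate_mate' := mate_mate
    enterUpper_mate' := fun a ha => by rw [type_mate a ha]
    pos_mate' := fun a ha => by rw [type_mate a ha]
    enter_mem' := fun a ha => (isTwist a ha).1.mem_left
    succ_enter' := fun a ha => (isTwist a ha).1.formPerm_apply D.nodup_word }⟩

namespace TwistPairing

variable {D : KnotDiagram} (M : TwistPairing D) {a b : ℕ}

/-- The passage through `a` that enters the twist. -/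
def enter (a : ℕ) : Pass := ⟨a, M.enterUpper a, M.pos a⟩

/-- The passage through `a` that leaves the twist. -/
def leave (a : ℕ) : Pass := ⟨a, !M.enterUpper a, M.pos a⟩

variable {M}

theorem mate_mate (ha : a ∈ D.crossings) : M.mate (M.mate a) = a := M.mate_mate' a ha

theorem enterUpper_mate (ha : a ∈ D.crossings) : M.enterUpper (M.mate a) = M.enterUpper a :=
  M.enterUpper_mate' a ha

theorem pos_mate (ha : a ∈ D.crossings) : M.pos (M.mate a) = M.pos a := M.pos_mate' a ha

theorem enter_mem (ha : a ∈ D.crossings) : M.enter a ∈ D.word := M.enter_mem' a ha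

theorem leave_mem (ha : a ∈ D.crossings) : M.leave a ∈ D.word := D.closed _ (enter_mem ha)

theorem mate_mem (ha : a ∈ D.crossings) : M.mate a ∈ D.crossings := by
  have h := List.formPerm_apply_mem_of_mem (M.enter_mem' a ha)
  rw [M.succ_enter' a ha] at h
  exact label_mem h

theorem succ_enter (ha : a ∈ D.crossings) :
    D.word.formPerm (M.enter a) = M.leave (M.mate a) := by
  rw [leave, enterUpper_mate ha, pos_mate ha]
  exact M.succ_enter' a ha

theorem enter_ne_leave : M.enter a ≠ M.leave b := by
  intro h
  obtain rfl : a = b := congrArg Pass.label h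
  simp [enter, leave] at h

theorem eq_enter_or_leave {x : Pass} (hx : x ∈ D.word) :
    x = M.enter x.label ∨ x = M.leave x.label := by
  have ha := label_mem hx
  by_cases h : x.upper = M.enterUpper x.label
  · exact Or.inl (D.eq_of_mem hx (enter_mem ha) rfl h)
  · exact Or.inr (D.eq_of_mem hx (leave_mem ha) rfl (Bool.eq_not.2 h))

theorem exists_succ_leave (ha : a ∈ D.crossings) :
    ∃ b ∈ D.crossings, D.word.formPerm (M.leave a) = M.enter b := by
  have hx := List.formPerm_apply_mem_of_mem (leave_mem (M := M) ha)
  have hb := label_mem hx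
  refine ⟨_, hb, (eq_enter_or_leave hx).resolve_right fun h => ?_⟩
  rw [← mate_mate (M := M) hb, ← succ_enter (mate_mem hb), EmbeddingLike.apply_eq_iff_eq] at h
  exact enter_ne_leave h.symm

theorem twist_induction {C : ℕ → Prop} {a₀ : ℕ} (h₀ : a₀ ∈ D.crossings) (hC : C a₀)
    (hS : ∀ a ∈ D.crossings, ∀ b ∈ D.crossings,
      D.word.formPerm (M.leave (M.mate a)) = M.enter b → C a → C b)
    (ha : a ∈ D.crossings) : C a := by
  refine cyclic_induction D.nodup_word
    (C := fun x => ∀ a ∈ D.crossings, x = M.enter a ∨ x = M.leave (M.mate a) → C a)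
    (enter_mem (M := M) h₀) ?_ ?_ (enter_mem (M := M) ha) a ha (Or.inl rfl)
  · rintro a ha (h | h)
    · obtain rfl : a₀ = a := congrArg Pass.label h
      exact hC
    · exact absurd h enter_ne_leave
  · rintro x hx ih a ha (h | h)
    · have hc := label_mem hx
      rcases eq_enter_or_leave (M := M) hx with hx' | hx'
      · rw [hx', succ_enter hc] at h
        exact absurd h.symm enter_ne_leave
      · rw [← mate_mate (M := M) hc] at hx'
        exact hS _ (mate_mem hc) a ha (hx' ▸ h) (ih _ (mate_mem hc) (Or.inr hx'))
    · rw [← succ_enter ha, EmbeddingLike.apply_eq_iff_eq] at h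
      exact ih a ha (Or.inl h)

end TwistPairing

/-! ### Functions on the faces -/

instance {w : List Pass} : Finite (Dart w) :=
  ((List.finite_toSet w).prod (Set.finite_univ (α := Bool))).subset fun _ h => ⟨h, trivial⟩

section Faces

variable (R : Type*) [CommRing R] (D : KnotDiagram)

open Classical in
/-- The value of a function on the faces at the face on the left of a directed edge, as a linear
form on these functions. -/
noncomputable def dartValue (d : Pass × Bool) : (Faces D.word → R) →ₗ[R] R :=
  if h : d.1 ∈ D.word then LinearMap.proj (Quot.mk _ ⟨d, h⟩ : Faces D.word) else 0

variable {R D}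

theorem dartValue_apply {d : Pass × Bool} (h : d.1 ∈ D.word) (Φ : Faces D.word → R) :
    dartValue R D d Φ = Φ (Quot.mk _ ⟨d, h⟩) := by
  rw [dartValue, dif_pos h, LinearMap.proj_apply]

theorem dartValue_faceStep {d : Pass × Bool} (h : d.1 ∈ D.word) :
    dartValue R D (faceStep D.word d) = dartValue R D d := by
  have hstep : (faceStep D.word d).1 ∈ D.word := by
    obtain ⟨x, b⟩ := d
    refine D.closed _ ?_
    cases b
    · simpa [cyclicSucc_reverse_eq_formPerm_symm D.nodup_word, formPerm_symm_mem_iff_mem] using h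
    · simpa [cyclicSucc_eq_formPerm D.nodup_word] using h
  ext1 Φ
  rw [dartValue_apply h, dartValue_apply hstep]
  exact congrArg Φ (Quot.sound (r := fun d e : Dart D.word => faceStep D.word d.1 = e.1) rfl).symm

variable (R D) in
/-- The value on the left (for `b = true`) or on the right (for `b = false`) of the edge that runs
into the passage `x`. -/
noncomputable def sideValue (b : Bool) (x : Pass) : (Faces D.word → R) →ₗ[R] R :=
  if b then dartValue R D (D.word.formPerm.symm x, true) else dartValue R D (x, false)

theorem sideValue_flip {x : Pass} (hx : x ∈ D.word) :
    sideValue R D x.otherToLeft x = sideValue R D x.otherToLeft (D.word.formPerm x.flip) ∧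
    sideValue R D (!x.otherToLeft) x = sideValue R D x.otherToLeft x.flip ∧
    sideValue R D x.otherToLeft (D.word.formPerm x) =
      sideValue R D (!x.otherToLeft) (D.word.formPerm x.flip) := by
  have hflip : x.flip.flip = x := by simp [Pass.flip]
  have hother : x.flip.otherToLeft = !x.otherToLeft := by
    simp only [Pass.otherToLeft, Pass.flip]
    cases x.upper <;> cases x.pos <;> rfl
  have left_in : ∀ y ∈ D.word, dartValue R D (y.flip, y.otherToLeft) = sideValue R D true y := by
    intro y hy
    have h := dartValue_faceStep (R := R) (d := (D.word.formPerm.symm y, true))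
      (formPerm_symm_mem_iff_mem.2 hy)
    simpa [sideValue, faceStep, cyclicSucc_eq_formPerm D.nodup_word] using h
  have right_out : ∀ y ∈ D.word,
      dartValue R D (y.flip, !y.otherToLeft) = sideValue R D false (D.word.formPerm y) := by
    intro y hy
    have h := dartValue_faceStep (R := R) (d := (D.word.formPerm y, false))
      (List.formPerm_apply_mem_of_mem hy)
    simpa [sideValue, faceStep, cyclicSucc_reverse_eq_formPerm_symm D.nodup_word] using h
  have h₁ := left_in x hx
  have h₂ := left_in x.flip (D.closed x hx)
  have h₃ := right_out x hx
  have h₄ := right_out x.flip (D.closed x hx)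
  rw [hother, hflip] at h₂ h₄
  cases hτ : x.otherToLeft <;> simp_all [sideValue]

theorem eq_zero_of_sideValue_eq_zero {Φ : Faces D.word → R}
    (h : ∀ b, ∀ x ∈ D.word, sideValue R D b x Φ = 0) : Φ = 0 := by
  funext q
  obtain ⟨⟨⟨x, b⟩, hx⟩, rfl⟩ := Quot.exists_rep q
  refine (dartValue_apply hx Φ).symm.trans ?_
  cases b
  · exact h false x hx
  · simpa [sideValue] using h true _ (List.formPerm_apply_mem_of_mem hx)

end Faces

namespace TwistPairing

variable (R : Type*) [CommRing R] {D : KnotDiagram} (M : TwistPairing D) {a b : ℕ}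

/-- Whether the strand that leaves the twist at `a` runs to the left, seen from the strand that
enters it there. This is the side that changes its face along the twist, while the bigon is on the
other side. -/
def side (a : ℕ) : Bool := (M.enter a).otherToLeft

/-- The value at the face at the end of the twist next to the crossing `a`. -/
noncomputable def tip (a : ℕ) : (Faces D.word → R) →ₗ[R] R := sideValue R D (M.side a) (M.enter a)

/-- The value at the face along the twist that borders the edge that enters it at `a`. -/
noncomputable def flank (a : ℕ) : (Faces D.word → R) →ₗ[R] R :=
  sideValue R D (!M.side a) (M.enter a)

/-- The value at the bigon of the twist. -/
noncomputable def bigon (a : ℕ) : (Faces D.word → R) →ₗ[R] R :=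
  sideValue R D (!M.side a) (M.leave a)

variable {R M}

theorem side_mate (ha : a ∈ D.crossings) : M.side (M.mate a) = M.side a := by
  simp [side, enter, Pass.otherToLeft, enterUpper_mate ha, pos_mate ha]

theorem flip_leave : (M.leave a).flip = M.enter a := by simp [Pass.flip, enter, leave]

theorem otherToLeft_leave : (M.leave a).otherToLeft = !M.side a := by
  simp only [Pass.otherToLeft, leave, side, enter]
  cases M.enterUpper a <;> cases M.pos a <;> rfl

theorem sideValue_leave (ha : a ∈ D.crossings) :
    sideValue R D (M.side a) (M.leave a) = flank R M a :=
  ((sideValue_flip (enter_mem ha)).2.1).symm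

theorem sideValue_succ_leave (ha : a ∈ D.crossings) :
    sideValue R D (M.side a) (D.word.formPerm (M.leave a)) = tip R M a :=
  ((sideValue_flip (enter_mem ha)).1).symm

theorem bigon_mate (ha : a ∈ D.crossings) : bigon R M (M.mate a) = bigon R M a := by
  have h := (sideValue_flip (R := R) (leave_mem (M := M) ha)).1
  rw [otherToLeft_leave, flip_leave, succ_enter ha] at h
  rw [bigon, bigon, side_mate ha, h]

theorem sideValue_not_succ_leave (ha : a ∈ D.crossings) :
    sideValue R D (!M.side a) (D.word.formPerm (M.leave a)) = flank R M (M.mate a) := by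
  have h := (sideValue_flip (R := R) (leave_mem (M := M) ha)).2.2
  rw [otherToLeft_leave, flip_leave, succ_enter ha, Bool.not_not] at h
  rw [h, ← sideValue_leave (mate_mem ha), side_mate ha]

theorem sideValue_add_sideValue_not (b c : Bool) (x : Pass) :
    sideValue R D b x + sideValue R D (!b) x = sideValue R D c x + sideValue R D (!c) x := by
  cases b <;> cases c <;> simp [add_comm]

theorem tip_add_flank (ha : a ∈ D.crossings)
    (hab : D.word.formPerm (M.leave (M.mate a)) = M.enter b) :
    tip R M b + flank R M b = tip R M (M.mate a) + flank R M a := by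
  rw [tip, flank, sideValue_add_sideValue_not _ (M.side (M.mate a)), ← hab,
    sideValue_succ_leave (mate_mem ha), sideValue_not_succ_leave (mate_mem ha), mate_mate ha]

variable (R M) in
/-- Coordinates on the space of functions on the faces: the values on both sides of the edge that
runs into `M.enter a₀` and, for every crossing, the change from one tip to the other plus the value
at the bigon. -/
noncomputable def faceCoords (a₀ : ℕ) :
    (Faces D.word → R) →ₗ[R] R × R × (D.crossings → R) :=
  (tip R M a₀).prod ((flank R M a₀).prod
    (LinearMap.pi fun a => tip R M (M.mate a) - tip R M a + bigon R M a))

variable {K : Type*} [Field K]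

/-- Since the bigon has the same value at both crossings of a twist while the change from one tip to
the other is antisymmetric, the two coordinates of a twist determine both. -/
theorem bigon_eq_zero_and_tip_mate (h2 : (2 : K) ≠ 0) {a₀ : ℕ} {Φ : Faces D.word → K}
    {J : ℕ → K} (hJ : ∀ a ∈ D.crossings, J (M.mate a) = -J a)
    (hΦ : (faceCoords K M a₀ Φ).2.2 = fun a : D.crossings => J a) (ha : a ∈ D.crossings) :
    bigon K M a Φ = 0 ∧ tip K M (M.mate a) Φ = tip K M a Φ + J a := by
  have h₁ : tip K M (M.mate a) Φ - tip K M a Φ + bigon K M a Φ = J a := congrFun hΦ ⟨a, ha⟩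
  have h₂ : tip K M (M.mate (M.mate a)) Φ - tip K M (M.mate a) Φ + bigon K M (M.mate a) Φ =
      J (M.mate a) := congrFun hΦ ⟨M.mate a, mate_mem ha⟩
  rw [mate_mate ha, bigon_mate ha, hJ a ha] at h₂
  have h₀ : bigon K M a Φ = 0 := by
    refine (mul_eq_zero.1 ?_).resolve_left h2
    linear_combination h₁ + h₂
  exact ⟨h₀, by linear_combination h₁ - h₀⟩

theorem faceCoords_injective (h2 : (2 : K) ≠ 0) {a₀ : ℕ} (h₀ : a₀ ∈ D.crossings) :
    Function.Injective (faceCoords K M a₀) := by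
  rw [← LinearMap.ker_eq_bot, LinearMap.ker_eq_bot']
  intro Φ hΦ
  have twist : ∀ a ∈ D.crossings, bigon K M a Φ = 0 ∧ tip K M (M.mate a) Φ = tip K M a Φ := by
    intro a ha
    simpa using bigon_eq_zero_and_tip_mate (J := 0) h2 (by simp) (congrArg (·.2.2) hΦ) ha
  have enter : ∀ a ∈ D.crossings, ∀ b, sideValue K D b (M.enter a) Φ = 0 := by
    intro a ha
    refine twist_induction (M := M) (C := fun a => ∀ b, sideValue K D b (M.enter a) Φ = 0) h₀ ?_
      (fun a ha b _ hab ih => ?_) ha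
    · have htip : tip K M a₀ Φ = 0 := congrArg Prod.fst hΦ
      have hflank : flank K M a₀ Φ = 0 := congrArg (·.2.1) hΦ
      exact (Bool.forall_bool' (M.side a₀)).2 ⟨htip, hflank⟩
    · rw [Bool.forall_bool' (M.side (M.mate a)), ← hab, sideValue_succ_leave (mate_mem ha),
        sideValue_not_succ_leave (mate_mem ha), mate_mate ha, (twist a ha).2]
      exact ⟨ih _, ih _⟩
  refine eq_zero_of_sideValue_eq_zero fun b x hx => ?_
  have ha := label_mem hx
  rcases eq_enter_or_leave (M := M) hx with h | h <;> rw [h]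
  · exact enter _ ha b
  · revert b
    rw [Bool.forall_bool' (M.side x.label), sideValue_leave ha]
    exact ⟨enter _ ha _, (twist _ ha).1⟩

/-- There are as many coordinates as faces, by Euler's formula. -/
theorem faceCoords_surjective (h2 : (2 : K) ≠ 0) {a₀ : ℕ} (h₀ : a₀ ∈ D.crossings) :
    Function.Surjective (faceCoords K M a₀) := by
  have : Fintype (Faces D.word) := Fintype.ofFinite _
  refine (LinearMap.injective_iff_surjective_of_finrank_eq_finrank ?_).1
    (faceCoords_injective h2 h₀)
  have heuler : 2 * Nat.card (Faces D.word) = D.word.length + 4 := by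
    refine D.spherical.resolve_left fun h => ?_
    simp [crossings, h] at h₀
  rw [D.length_word, Nat.card_eq_fintype_card] at heuler
  simp only [Module.finrank_prod, Module.finrank_fintype_fun_eq_card, Module.finrank_self,
    Fintype.card_coe]
  lia

theorem exists_face_function (h2 : (2 : K) ≠ 0) {g : Pass → K}
    (hg : ∀ a ∈ D.crossings,
      g (D.word.formPerm (M.leave (M.mate a))) - g (M.enter a) =
        g (M.enter (M.mate a)) - g (D.word.formPerm (M.leave a))) :
    ∃ Φ : Faces D.word → K, ∀ a ∈ D.crossings, tip K M a Φ + flank K M a Φ = g (M.enter a) := by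
  obtain h | ⟨a₀, h₀⟩ := D.crossings.eq_empty_or_nonempty
  · exact ⟨0, by simp [h]⟩
  let J (a : ℕ) : K := g (D.word.formPerm (M.leave (M.mate a))) - g (M.enter a)
  have hJ : ∀ a ∈ D.crossings, J (M.mate a) = -J a := fun a ha => by
    simp only [J, mate_mate ha, hg a ha, neg_sub]
  obtain ⟨Φ, hΦ⟩ := faceCoords_surjective (M := M) h2 h₀ (g (M.enter a₀), 0, fun a => J a)
  have base : tip K M a₀ Φ + flank K M a₀ Φ = g (M.enter a₀) := by
    rw [show tip K M a₀ Φ = g (M.enter a₀) from congrArg Prod.fst hΦ,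
      show flank K M a₀ Φ = 0 from congrArg (·.2.1) hΦ, add_zero]
  refine ⟨Φ, fun a ha => twist_induction (M := M)
    (C := fun a => tip K M a Φ + flank K M a Φ = g (M.enter a)) h₀ base
    (fun a ha b _ hab ih => ?_) ha⟩
  have hsum := LinearMap.congr_fun (tip_add_flank (R := K) ha hab) Φ
  simp only [LinearMap.add_apply] at hsum
  rw [hsum, (bigon_eq_zero_and_tip_mate h2 hJ (congrArg (·.2.2) hΦ) ha).2, ← hab]
  simp only [J]
  linear_combination ih

end TwistPairing

/-! ### Colourings of matched diagrams -/

namespace TwistPairing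

section TwistColouring

variable {Q : Type*} {D : KnotDiagram} (M : TwistPairing D) {a : ℕ}

/-- The colour of the upper strand at the crossing `a`, when `h` gives the colours of the edges that
run into the twists. -/
def upperColour (h : Pass → Q) (a : ℕ) : Q :=
  if M.enterUpper a then h (M.enter a) else h (D.word.formPerm (M.leave a))

/-- The colour of the edge that runs into `x`, when `h` gives the colours of the edges that run into
the twists. -/
def edgeColour (h : Pass → Q) (x : Pass) : Q :=
  if x.upper = M.enterUpper x.label then h x
  else if M.enterUpper x.label then h (M.enter (M.mate x.label)) else h (D.word.formPerm x)

variable {M} {h : Pass → Q}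

theorem edgeColour_enter : M.edgeColour h (M.enter a) = h (M.enter a) := by
  simp [edgeColour, enter]

theorem edgeColour_leave : M.edgeColour h (M.leave a) =
    if M.enterUpper a then h (M.enter (M.mate a)) else h (D.word.formPerm (M.leave a)) := by
  rw [edgeColour, if_neg (by simp [leave])]
  rfl

theorem edgeColour_succ_leave (ha : a ∈ D.crossings) :
    M.edgeColour h (D.word.formPerm (M.leave a)) = h (D.word.formPerm (M.leave a)) := by
  obtain ⟨b, -, hb⟩ := exists_succ_leave (M := M) ha
  rw [hb, edgeColour_enter]

variable [Quandle Q] {f : ℕ → Q}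

variable (M) in
/-- The condition that the colours `h` of the edges that run into the twists extend to a colouring
of the diagram. -/
def IsTwistColouring (h : Pass → Q) : Prop :=
  ∀ a ∈ D.crossings,
    if M.enterUpper a then
      h (D.word.formPerm (M.leave a)) = underpass (M.pos a) (h (M.enter a)) (h (M.enter (M.mate a)))
    else
      h (D.word.formPerm (M.leave (M.mate a))) =
        underpass (M.pos a) (h (D.word.formPerm (M.leave a))) (h (M.enter a))

theorem runs_enter {x y : Q} : Runs f x [M.enter a] y ↔
    if M.enterUpper a then x = f a ∧ x = y else underpass (M.pos a) (f a) x = y := by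
  cases hu : M.enterUpper a <;> simp [enter, hu]

theorem runs_leave {x y : Q} : Runs f x [M.leave a] y ↔
    if M.enterUpper a then underpass (M.pos a) (f a) x = y else x = f a ∧ x = y := by
  cases hu : M.enterUpper a <;> simp [leave, hu]

theorem isEdgeColouring_iff : IsEdgeColouring D.word f h ↔
    ∀ a ∈ D.crossings, Runs f (h (M.enter a)) [M.enter a] (h (M.leave (M.mate a))) ∧
      Runs f (h (M.leave a)) [M.leave a] (h (D.word.formPerm (M.leave a))) := by
  refine ⟨fun H a ha => ⟨?_, H _ (leave_mem ha)⟩, fun H x hx => ?_⟩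
  · rw [← succ_enter ha]
    exact H _ (enter_mem ha)
  · have ha := label_mem hx
    rcases eq_enter_or_leave (M := M) hx with h | h <;> rw [h]
    · rw [succ_enter ha]
      exact (H _ ha).1
    · exact (H _ ha).2

theorem IsTwistColouring.isEdgeColouring (H : M.IsTwistColouring h) :
    IsEdgeColouring D.word (M.upperColour h) (M.edgeColour h) := by
  refine (isEdgeColouring_iff (M := M)).2 fun a ha => ?_
  have Ha := H a ha
  rw [runs_enter, runs_leave, edgeColour_enter, edgeColour_leave, edgeColour_leave,
    edgeColour_succ_leave ha, mate_mate ha, enterUpper_mate ha, upperColour]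
  cases hu : M.enterUpper a <;> simp_all

theorem isTwistColouring_of_isEdgeColouring (H : IsEdgeColouring D.word f h) :
    M.IsTwistColouring h ∧ (∀ a ∈ D.crossings, f a = M.upperColour h a) ∧
      ∀ x ∈ D.word, h x = M.edgeColour h x := by
  have H' := (isEdgeColouring_iff (M := M)).1 H
  simp only [runs_enter, runs_leave] at H'
  refine ⟨fun a ha => ?_, fun a ha => ?_, fun x hx => ?_⟩
  · have Ha := H' a ha
    have Hm := H' _ (mate_mem (M := M) ha)
    rw [mate_mate ha, enterUpper_mate ha] at Hm
    grind
  · have Ha := H' a ha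
    grind [upperColour]
  · have ha := label_mem hx
    have Ha := H' _ ha
    have Hm := H' _ (mate_mem (M := M) ha)
    rw [mate_mate ha, enterUpper_mate ha] at Hm
    rcases eq_enter_or_leave (M := M) hx with h | h <;> rw [h]
    · rw [edgeColour_enter]
    · rw [edgeColour_leave]
      grind

variable {Q' : Type*} [Quandle Q'] {π : Q →◃ Q'}

theorem lifts_of_isTwistColouring (hπ : Function.Surjective π)
    (H : ∀ h : Pass → Q', M.IsTwistColouring h →
      ∃ k : Pass → Q, M.IsTwistColouring k ∧ ∀ x, π (k x) = h x) : Lifts π D.word := by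
  refine Lifts.of_edgeColouring D.nodup_word hπ fun f h hfh => ?_
  obtain ⟨hh, hf, he⟩ := isTwistColouring_of_isEdgeColouring (M := M) hfh
  obtain ⟨k, hk, hkh⟩ := H h hh
  refine ⟨M.upperColour k, M.edgeColour k, hk.isEdgeColouring, fun x hx => ?_, fun x hx => ?_⟩
  · simp only [hf _ (label_mem hx), upperColour, apply_ite π, hkh]
  · rw [he x hx]
    simp only [edgeColour, apply_ite π, hkh]

end TwistColouring

end TwistPairing

/-! ### Fox colourings and their first-order deformations -/

section Fox

open DualNumber

variable (R : Type*) [CommRing R]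

/-- The sign of a crossing that is positive if `b = true`. -/
def crossingSign (b : Bool) : R := if b then 1 else -1

/-- The quandle of Fox colourings with values in `R`. -/
abbrev FoxQuandle : Type _ := AlexanderQuandle (-1 : Rˣ)

/-- The dual number `-1 + ε` as a unit. -/
def negOneAddEps : R[ε]ˣ where
  val := -1 + ε
  inv := -1 - ε
  val_inv := by ring_nf; simp [pow_two]
  inv_val := by ring_nf; simp [pow_two]

/-- The Alexander quandle with `t = -1 + ε`. Its colourings are the first-order deformations of Fox
colourings in the direction of the parameter `t`. -/
abbrev FoxDeformation : Type _ := AlexanderQuandle (negOneAddEps R)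

variable {R} in
/-- The deformation `x + y * ε` of the colour `x`. -/
def FoxDeformation.mk (x y : R) : FoxDeformation R := ((x, y) : R × R)

/-- The reduction of deformations of Fox colourings modulo `ε`. -/
def FoxDeformation.reduce : FoxDeformation R →◃ FoxQuandle R :=
  AlexanderQuandle.map (TrivSqZeroExt.fstHom R R R : R[ε] →+* R) (by simp [negOneAddEps])

variable {R}

theorem FoxDeformation.reduce_surjective : Function.Surjective (reduce R) :=
  fun x : R => ⟨TrivSqZeroExt.inl x, TrivSqZeroExt.fst_inl R x⟩

theorem FoxQuandle.underpass_eq (b : Bool) (y x : R) :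
    underpass (Q := FoxQuandle R) b y x = (2 * y - x : R) := by
  refine (AlexanderQuandle.underpass_eq b y x).trans ?_
  change AlexanderQuandle.act (R := R) _ _ _ = _
  cases b <;> simp [AlexanderQuandle.act] <;> ring

theorem FoxDeformation.eq_underpass_iff {b : Bool} {x y z : R[ε]} :
    z = underpass (Q := FoxDeformation R) b y x ↔ z.fst = 2 * y.fst - x.fst ∧
      z.snd = 2 * y.snd - x.snd + crossingSign R b * (x.fst - y.fst) := by
  refine (Eq.congr_right (AlexanderQuandle.underpass_eq (R := R[ε]) b y x)).trans ?_
  refine TrivSqZeroExt.ext_iff.trans ?_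
  cases b <;> simp [AlexanderQuandle.act, negOneAddEps, crossingSign] <;> ring_nf

end Fox

namespace TwistPairing

variable {R : Type*} [CommRing R] {D : KnotDiagram} {M : TwistPairing D} {a : ℕ}

theorem isTwistColouring_fox_iff {g : Pass → R} :
    M.IsTwistColouring (Q := FoxQuandle R) g ↔ ∀ a ∈ D.crossings,
      if M.enterUpper a then
        g (D.word.formPerm (M.leave a)) = 2 * g (M.enter a) - g (M.enter (M.mate a))
      else
        g (D.word.formPerm (M.leave (M.mate a))) =
          2 * g (D.word.formPerm (M.leave a)) - g (M.enter a) :=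
  forall₂_congr fun a _ => by
    simp only [FoxQuandle.underpass_eq]
    rfl

theorem IsTwistColouring.sub_eq_sub {g : Pass → R} (H : M.IsTwistColouring (Q := FoxQuandle R) g)
    (ha : a ∈ D.crossings) :
    g (D.word.formPerm (M.leave (M.mate a))) - g (M.enter a) =
      g (M.enter (M.mate a)) - g (D.word.formPerm (M.leave a)) := by
  have Ha := isTwistColouring_fox_iff.1 H a ha
  have Hm := isTwistColouring_fox_iff.1 H _ (mate_mem (M := M) ha)
  rw [mate_mate ha, enterUpper_mate ha] at Hm
  split_ifs at Ha Hm
  · linear_combination Ha + Hm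
  · linear_combination -Ha - Hm

theorem crossingSign_side : crossingSign R (M.side a) =
    if M.enterUpper a then crossingSign R (M.pos a) else -crossingSign R (M.pos a) := by
  cases hu : M.enterUpper a <;> cases hp : M.pos a <;>
    simp [side, enter, Pass.otherToLeft, crossingSign, hu, hp]

variable {K : Type*} [Field K]

variable (D K) in
/-- A quarter of the value on the left minus the value on the right of the edge that runs into `x`.
This is how fast the colour of this edge moves when `t` moves away from `-1`. -/
noncomputable def slope (Φ : Faces D.word → K) (x : Pass) : K :=
  4⁻¹ * (sideValue K D true x Φ - sideValue K D false x Φ)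

theorem slope_eq (b : Bool) (Φ : Faces D.word → K) (x : Pass) :
    slope D K Φ x = 4⁻¹ * crossingSign K b * (sideValue K D b x Φ - sideValue K D (!b) x Φ) := by
  cases b
  · simp only [slope, crossingSign, Bool.false_eq_true, if_false, Bool.not_false]
    ring
  · simp [slope, crossingSign]

theorem slope_enter (Φ : Faces D.word → K) :
    slope D K Φ (M.enter a) = 4⁻¹ * crossingSign K (M.side a) * (tip K M a Φ - flank K M a Φ) :=
  slope_eq _ _ _

theorem slope_succ_leave (Φ : Faces D.word → K) (ha : a ∈ D.crossings) :
    slope D K Φ (D.word.formPerm (M.leave a)) =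
      4⁻¹ * crossingSign K (M.side a) * (tip K M a Φ - flank K M (M.mate a) Φ) := by
  rw [slope_eq (M.side a), sideValue_succ_leave ha, sideValue_not_succ_leave ha]

theorem colour_succ_leave {g : Pass → K} {Φ : Faces D.word → K}
    (hΦ : ∀ a ∈ D.crossings, tip K M a Φ + flank K M a Φ = g (M.enter a)) (ha : a ∈ D.crossings) :
    g (D.word.formPerm (M.leave a)) = tip K M a Φ + flank K M (M.mate a) Φ := by
  obtain ⟨b, hb, hab⟩ := exists_succ_leave (M := M) ha
  rw [hab, ← hΦ b hb]
  rw [← mate_mate (M := M) ha] at hab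
  simpa [mate_mate ha] using LinearMap.congr_fun (tip_add_flank (R := K) (mate_mem ha) hab) Φ

theorem isTwistColouring_deformation (h2 : (2 : K) ≠ 0) {g : Pass → K}
    (hg : M.IsTwistColouring (Q := FoxQuandle K) g) {Φ : Faces D.word → K}
    (hΦ : ∀ a ∈ D.crossings, tip K M a Φ + flank K M a Φ = g (M.enter a)) :
    M.IsTwistColouring (Q := FoxDeformation K) fun x =>
      FoxDeformation.mk (g x) (slope D K Φ x) := by
  have h4 : (4 : K) * 4⁻¹ = 1 := mul_inv_cancel₀ (by simpa [show (4 : K) = 2 * 2 by norm_num])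
  have hsucc := fun a ha => colour_succ_leave (M := M) (a := a) hΦ ha
  intro a ha
  have hm := mate_mem (M := M) ha
  have Ha := isTwistColouring_fox_iff.1 hg a ha
  have hside := crossingSign_side (R := K) (M := M) (a := a)
  split_ifs at Ha hside ⊢ with hu <;> refine FoxDeformation.eq_underpass_iff.2 ⟨Ha, ?_⟩
  · change slope D K Φ _ = 2 * slope D K Φ _ - slope D K Φ _ + _ * (g _ - g _)
    rw [hsucc a ha, ← hΦ a ha, ← hΦ _ hm] at Ha
    rw [slope_succ_leave Φ ha, slope_enter, slope_enter, side_mate ha, hside, ← hΦ a ha, ← hΦ _ hm]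
    linear_combination (-3 * 4⁻¹ * crossingSign K (M.pos a)) * Ha +
      crossingSign K (M.pos a) * (tip K M (M.mate a) Φ + flank K M (M.mate a) Φ -
        tip K M a Φ - flank K M a Φ) * h4
  · change slope D K Φ _ = 2 * slope D K Φ _ - slope D K Φ _ + _ * (g _ - g _)
    rw [hsucc a ha, hsucc _ hm, ← hΦ a ha, mate_mate ha] at Ha
    rw [slope_succ_leave Φ ha, slope_succ_leave Φ hm, slope_enter, side_mate ha, mate_mate ha,
      hside, hsucc a ha, ← hΦ a ha]
    linear_combination (-4⁻¹ * crossingSign K (M.pos a)) * Ha +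
      crossingSign K (M.pos a) * (flank K M a Φ - flank K M (M.mate a) Φ) * h4

end TwistPairing

theorem KnotDiagram.IsMatched.lifts {K : Type*} [Field K] (h2 : (2 : K) ≠ 0) {D : KnotDiagram}
    (hD : D.IsMatched) : Lifts (FoxDeformation.reduce K) D.word := by
  obtain ⟨M⟩ := hD.exists_twistPairing
  refine M.lifts_of_isTwistColouring FoxDeformation.reduce_surjective fun (g : Pass → K) hg => ?_
  obtain ⟨Φ, hΦ⟩ := TwistPairing.exists_face_function h2 fun a ha => hg.sub_eq_sub ha
  exact ⟨_, TwistPairing.isTwistColouring_deformation h2 hg hΦ, fun x => rfl⟩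

/-! ### Colourings without a lift -/

section Obstruction

open DualNumber

instance Runs.decidable {Q : Type*} [Quandle Q] [DecidableEq Q] (f : ℕ → Q) :
    ∀ (x : Q) (w : List Pass) (y : Q), Decidable (Runs f x w y)
  | x, [], y => decEq x y
  | x, p :: w, y =>
    have := Runs.decidable f x w y
    have := Runs.decidable f (underpass p.pos (f p.label) x) w y
    inferInstanceAs (Decidable (if p.upper then x = f p.label ∧ Runs f x w y else _))

variable {R : Type*} [CommRing R]

/-- The multiple `μ * y` of the `ε`-part `y` of a colour turns into the multiple `ν * z` of the
`ε`-part `z` of the colour behind the passages of `w`, up to constants and to the `ε`-parts of the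
upper strands, if the equation of the crossing `c` is multiplied by `m c`. At an upper passage of
`c`, twice the equation of the upper strand is added with the same multiplier: this makes the
`ε`-parts of the upper strands cancel along the whole knot. -/
def DualRuns (m : ℕ → R) : R → List Pass → R → Prop
  | μ, [], ν => μ = ν
  | μ, p :: w, ν =>
    if p.upper then DualRuns m (μ + 2 * m p.label) w ν else μ = m p.label ∧ DualRuns m (-μ) w ν

instance DualRuns.decidable [DecidableEq R] (m : ℕ → R) :
    ∀ (μ : R) (w : List Pass) (ν : R), Decidable (DualRuns m μ w ν)
  | μ, [], ν => decEq μ ν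
  | μ, p :: w, ν =>
    have := DualRuns.decidable m (μ + 2 * m p.label) w ν
    have := DualRuns.decidable m (-μ) w ν
    inferInstanceAs (Decidable (if p.upper then _ else μ = m p.label ∧ DualRuns m (-μ) w ν))

/-- The constant that the equations of the crossings contribute to `DualRuns`, along the Fox
colouring given by `f` and the initial colour `x`. -/
def defect (f m : ℕ → R) : R → List Pass → R
  | _, [] => 0
  | x, p :: w =>
    if p.upper then defect f m x w
    else crossingSign R p.pos * m p.label * (x - f p.label) + defect f m (2 * f p.label - x) w

theorem Runs.dual_identity {f m : ℕ → R} {g : ℕ → R[ε]} {w : List Pass} {y z : R[ε]} {μ ν : R}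
    (hr : Runs (Q := FoxDeformation R) g y w z) (hg : ∀ p ∈ w, (g p.label).fst = f p.label)
    (hm : DualRuns m μ w ν) :
    μ * y.snd + (w.map fun p => if p.upper then 2 * m p.label * (g p.label).snd else 0).sum =
      ν * z.snd + defect f m y.fst w +
        (w.map fun p => if p.flip.upper then 2 * m p.label * (g p.label).snd else 0).sum := by
  induction w generalizing y μ with
  | nil =>
    obtain rfl : y = z := hr
    obtain rfl : μ = ν := hm
    simp [defect]
  | cons p w ih =>
    obtain ⟨a, _ | _, s⟩ := p
    · obtain ⟨hfst, hsnd⟩ := FoxDeformation.eq_underpass_iff.1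
        (rfl : _ = underpass (Q := FoxDeformation R) s (g a) y)
      obtain ⟨rfl, hm⟩ : μ = m a ∧ DualRuns m (-μ) w ν := hm
      have key := ih (runs_under_cons.1 hr) (fun p hp => hg p (.tail _ hp)) hm
      have hga : (g a).fst = f a := hg _ (.head _)
      rw [hfst, hsnd, hga] at key
      simp only [List.map_cons, List.sum_cons, Pass.flip, defect, Bool.false_eq_true, if_false,
        Bool.not_false, if_true] at key ⊢
      linear_combination key
    · obtain ⟨rfl, hr⟩ := runs_over_cons.1 hr
      have key := ih hr (fun p hp => hg p (.tail _ hp)) (hm : DualRuns m (μ + 2 * m a) w ν)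
      simp only [List.map_cons, List.sum_cons, Pass.flip, defect, Bool.false_eq_true, if_false,
        Bool.not_true, if_true] at key ⊢
      linear_combination key

namespace KnotDiagram

/-- A Fox colouring of the diagram, given by `f` and `x`, and multipliers `m`, `μ` such that the
equations of the crossings for the `ε`-parts of a lift sum up to `0 = c` with `c ≠ 0`. -/
def IsLiftObstruction (D : KnotDiagram) (f : ℕ → R) (x : R) (m : ℕ → R) (μ : R) : Prop :=
  Runs (Q := FoxQuandle R) f x D.word x ∧ DualRuns m μ D.word μ ∧ defect f m x D.word ≠ 0

instance [DecidableEq R] (D : KnotDiagram) (f : ℕ → R) (x : R) (m : ℕ → R) (μ : R) :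
    Decidable (D.IsLiftObstruction f x m μ) :=
  have := Runs.decidable (Q := FoxQuandle R) f x D.word x
  inferInstanceAs (Decidable (_ ∧ _ ∧ _))

variable {D : KnotDiagram}

theorem perm_map_flip (D : KnotDiagram) : D.word.Perm (D.word.map Pass.flip) := by
  have hflip : Function.Involutive Pass.flip := fun x => by simp [Pass.flip]
  refine (List.perm_ext_iff_of_nodup D.nodup_word (D.nodup_word.map hflip.injective)).2 fun x => ?_
  rw [List.mem_map]
  refine ⟨fun h => ⟨_, D.closed x h, hflip x⟩, ?_⟩
  rintro ⟨y, hy, rfl⟩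
  exact D.closed y hy

theorem IsLiftObstruction.not_lifts {f m : ℕ → R} {x μ : R} (h : D.IsLiftObstruction f x m μ) :
    ¬Lifts (FoxDeformation.reduce R) D.word := by
  intro hl
  obtain ⟨hf, hm, hd⟩ := h
  obtain ⟨g, y, hg, rfl, hr⟩ := hl f x hf
  have key := hr.dual_identity hg hm
  have hflip := (D.perm_map_flip.map
    fun p => if p.upper then 2 * m p.label * (g p.label : R[ε]).snd else 0).sum_eq
  rw [hflip, List.map_map, add_right_comm] at key
  exact hd (left_eq_add.1 (add_right_cancel (key.trans (add_right_comm ..))))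

theorem not_isBipartite_of_not_lifts {K : Type*} [Field K] (h2 : (2 : K) ≠ 0)
    (h : ¬Lifts (FoxDeformation.reduce K) D.word) : ¬D.IsBipartite :=
  fun ⟨_, hE, hM⟩ => h (hE.lifts_iff.2 (hM.lifts h2))

theorem not_isBipartite_of_isLiftObstruction (p : ℕ) (f : List (ZMod p)) (x : ZMod p)
    (m : List (ZMod p)) (μ : ZMod p)
    (h : p.Prime ∧ (2 : ZMod p) ≠ 0 ∧ D.IsLiftObstruction (f.getD · 0) x (m.getD · 0) μ) :
    ¬D.IsBipartite :=
  have : Fact p.Prime := ⟨h.1⟩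
  not_isBipartite_of_not_lifts h.2.1 h.2.2.not_lifts

end KnotDiagram

/-! The colourings and the multipliers are solutions of linear equations over the prime field. -/

theorem knot9_35_not_isBipartite : ¬knot9_35.IsBipartite :=
  not_isBipartite_of_isLiftObstruction 3
    [0, 1, 0, 1, 0, 2, 0, 0, 2] 1
    [0, 2, 1, 0, 0, 1, 2, 0, 0] 0
    (by decide +kernel)

theorem knot9_37_not_isBipartite : ¬knot9_37.IsBipartite :=
  not_isBipartite_of_isLiftObstruction 3
    [2, 0, 1, 0, 1, 0, 2, 0, 0] 0
    [0, 0, 2, 1, 0, 0, 1, 2, 0] 0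
    (by decide +kernel)

theorem knot9_41_not_isBipartite : ¬knot9_41.IsBipartite :=
  not_isBipartite_of_isLiftObstruction 7
    [6, 0, 2, 0, 3, 0, 4, 0, 1] 2
    [1, 3, 4, 3, 2, 0, 0, 6, 0] 0
    (by decide +kernel)

theorem knot9_46_not_isBipartite : ¬knot9_46.IsBipartite :=
  not_isBipartite_of_isLiftObstruction 3
    [1, 0, 0, 1, 0, 2, 2, 0, 0] 0
    [2, 2, 1, 2, 1, 2, 0, 2, 0] 1
    (by decide +kernel)

theorem pretzel33neg3_not_isBipartite : ¬pretzel33neg3.IsBipartite :=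
  not_isBipartite_of_isLiftObstruction 3
    [2, 0, 1, 0, 1, 0, 2, 0, 0] 0
    [0, 0, 2, 1, 0, 0, 1, 2, 0] 0
    (by decide +kernel)

theorem knot9_47_not_isBipartite : ¬knot9_47.IsBipartite :=
  not_isBipartite_of_isLiftObstruction 3
    [1, 0, 0, 2, 1, 0, 2, 2, 0] 0
    [0, 1, 1, 2, 1, 2, 0, 0, 0] 1
    (by decide +kernel)

theorem knot9_48_not_isBipartite : ¬knot9_48.IsBipartite :=
  not_isBipartite_of_isLiftObstruction 3
    [1, 0, 0, 1, 0, 2, 2, 0, 0] 0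
    [1, 2, 1, 2, 1, 0, 0, 2, 0] 0
    (by decide +kernel)

theorem knot9_49_not_isBipartite : ¬knot9_49.IsBipartite :=
  not_isBipartite_of_isLiftObstruction 5
    [0, 1, 2, 0, 2, 0, 3, 0, 1] 2
    [1, 2, 3, 2, 0, 0, 4, 0, 0] 0
    (by decide +kernel)

theorem knot10_74_not_isBipartite : ¬knot10_74.IsBipartite :=
  not_isBipartite_of_isLiftObstruction 3
    [1, 0, 0, 1, 0, 2, 1, 2, 0, 0] 0
    [2, 1, 1, 2, 1, 0, 1, 0, 2, 0] 0
    (by decide +kernel)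

theorem knot10_75_not_isBipartite : ¬knot10_75.IsBipartite :=
  not_isBipartite_of_isLiftObstruction 3
    [1, 1, 0, 0, 2, 0, 0, 2, 0, 0] 0
    [0, 2, 1, 0, 1, 2, 0, 1, 2, 0] 0
    (by decide +kernel)

theorem knot10_103_not_isBipartite : ¬knot10_103.IsBipartite :=
  not_isBipartite_of_isLiftObstruction 5
    [0, 3, 4, 1, 1, 0, 4, 3, 0, 2] 4
    [2, 4, 1, 2, 3, 0, 0, 4, 0, 0] 0
    (by decide +kernel)

theorem knot10_155_not_isBipartite : ¬knot10_155.IsBipartite :=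
  not_isBipartite_of_isLiftObstruction 5
    [2, 0, 0, 1, 4, 0, 1, 4, 3, 0] 0
    [2, 3, 0, 0, 0, 1, 4, 0, 0, 0] 2
    (by decide +kernel)

theorem knot10_157_not_isBipartite : ¬knot10_157.IsBipartite :=
  not_isBipartite_of_isLiftObstruction 7
    [1, 0, 2, 0, 2, 0, 0, 4, 0, 1] 2
    [2, 3, 4, 3, 4, 0, 0, 0, 6, 0] 0
    (by decide +kernel)

end Obstruction

/-! ### Mirror images -/

section Mirror

variable {w w' : List Pass}

theorem faceStep_eq_of_isRotated (hw : w.Nodup) (h : w ~r w') : faceStep w = faceStep w' := by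
  have hw' : w'.Nodup := h.nodup_iff.1 hw
  funext d
  simp only [faceStep, cyclicSucc_eq_formPerm hw, cyclicSucc_eq_formPerm hw',
    cyclicSucc_reverse_eq_formPerm_symm hw, cyclicSucc_reverse_eq_formPerm_symm hw',
    List.formPerm_eq_of_isRotated hw h]

theorem card_faces_eq_of_isRotated (hw : w.Nodup) (h : w ~r w') :
    Nat.card (Faces w) = Nat.card (Faces w') :=
  Nat.card_congr <| Quot.congr (Equiv.subtypeEquivRight fun _ => h.mem_iff) fun d e => by
    simp [faceStep_eq_of_isRotated hw h]

theorem Move.of_isRotated (h : w ~r w') : Move w w' := by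
  obtain ⟨n, rfl⟩ := h
  rw [List.rotate_eq_drop_append_take_mod]
  conv_lhs => rw [← List.take_append_drop (n % w.length) w]
  exact .rotate _ _

theorem map_mirror_arrange (e : Bool) (x y : Pass) :
    (arrange e x y).map Pass.mirror = arrange (!e) y.mirror x.mirror := by
  cases e <;> rfl

theorem map_mirror_append_isRotated (u v : List Pass) :
    (u ++ v).map Pass.mirror ~r v.map Pass.mirror ++ u.map Pass.mirror := by
  rw [List.map_append]
  exact List.isRotated_append

/-- The mirror image of a triangle has the upper and the lower strand exchanged, and the base point
has to be moved to the new upper strand. -/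
theorem Move.mirror (h : Move w w') :
    ∃ u u', w.map Pass.mirror ~r u ∧ Move u u' ∧ u' ~r w'.map Pass.mirror := by
  have hsign {o s e e' : Bool} (hs : s = (o == (e == e'))) : (!s) = ((!o) == ((!e') == !e)) := by
    revert o s e e'
    decide
  cases h with
  | rotate u v => exact ⟨_, _, by rw [List.map_append], .rotate _ _, by rw [List.map_append]⟩
  | relabel σ => exact ⟨_, _, .refl _, .relabel σ _, by rw [List.map_map, List.map_map]; rfl⟩
  | r1 a t s => exact ⟨_, _, .refl _, .r1 a (!t) (!s) _, .refl _⟩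
  | r2 a b s e u v =>
    have h := map_mirror_append_isRotated ([⟨a, true, s⟩, ⟨b, true, !s⟩] ++ u)
      (arrange e ⟨a, false, s⟩ ⟨b, false, !s⟩ ++ v)
    have huv := (map_mirror_append_isRotated u v).symm
    cases e
    · refine ⟨_, _, ?_, .r2 b a s false (v.map Pass.mirror) (u.map Pass.mirror), huv⟩
      simpa [arrange, Pass.mirror] using h
    · refine ⟨_, _, ?_, .r2 a b (!s) true (v.map Pass.mirror) (u.map Pass.mirror), huv⟩
      simpa [arrange, Pass.mirror] using h
  | r3 a b c o e₁ e₂ e₃ sa sb sc u v w hsa hsb hsc =>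
    have h (e₁ e₂ e₃) := map_mirror_append_isRotated
      (arrange e₁ ⟨a, true, sa⟩ ⟨b, true, sb⟩ ++ u ++ arrange e₂ ⟨a, false, sa⟩ ⟨c, true, sc⟩ ++ v)
      (arrange e₃ ⟨b, false, sb⟩ ⟨c, false, sc⟩ ++ w)
    simp only [List.map_append, map_mirror_arrange, ← List.append_assoc] at h ⊢
    exact ⟨_, _, h e₁ e₂ e₃, .r3' c b a (!o) (!e₃) (!e₂) (!e₁) (!sc) (!sb) (!sa) _ _ _
      (hsign hsc) (hsign hsb) (hsign hsa), (h (!e₁) (!e₂) (!e₃)).symm⟩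
  | r3' a b c o e₁ e₂ e₃ sa sb sc u v w hsa hsb hsc =>
    have h (e₁ e₂ e₃) := map_mirror_append_isRotated
      (arrange e₁ ⟨a, true, sa⟩ ⟨b, true, sb⟩ ++ u)
      (arrange e₃ ⟨b, false, sb⟩ ⟨c, false, sc⟩ ++ v ++ arrange e₂ ⟨a, false, sa⟩ ⟨c, true, sc⟩
        ++ w)
    simp only [List.map_append, map_mirror_arrange, ← List.append_assoc] at h ⊢
    exact ⟨_, _, h e₁ e₂ e₃, .r3 c b a (!o) (!e₃) (!e₂) (!e₁) (!sc) (!sb) (!sa) _ _ _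
      (hsign hsc) (hsign hsb) (hsign hsa), (h (!e₁) (!e₂) (!e₃)).symm⟩

namespace KnotDiagram

variable {D E : KnotDiagram}

theorem mirror_mirror (D : KnotDiagram) : D.mirror.mirror = D := by
  obtain ⟨w, _, _, _⟩ := D
  simp [KnotDiagram.mirror, Pass.mirror, Function.comp_def]

/-- The diagram `D` with another base point. -/
def ofIsRotated (D : KnotDiagram) (h : D.word ~r w) : KnotDiagram where
  word := w
  nodup := (h.map _).nodup_iff.1 D.nodup
  closed x hx := h.mem_iff.1 (D.closed x (h.mem_iff.2 hx))
  spherical := by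
    rw [IsSpherical, ← card_faces_eq_of_isRotated D.nodup_word h, ← h.perm.length_eq,
      ← List.length_eq_zero_iff, ← h.perm.length_eq, List.length_eq_zero_iff]
    exact D.spherical

theorem Equivalent.mirror (h : D.Equivalent E) : D.mirror.Equivalent E.mirror := by
  induction h with
  | rel D E h =>
    obtain ⟨u, u', hu, hm, hu'⟩ := h.mirror
    refine .trans _ (D.mirror.ofIsRotated hu) _ (.rel _ _ (.of_isRotated hu)) ?_
    exact .trans _ (E.mirror.ofIsRotated hu'.symm) _ (.rel _ _ hm) (.rel _ _ (.of_isRotated hu'))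
  | refl => exact .refl _
  | symm _ _ _ ih => exact .symm _ _ ih
  | trans _ _ _ _ _ ih₁ ih₂ => exact .trans _ _ _ ih₁ ih₂

end KnotDiagram

theorem Consecutive.mirror {x y : Pass} (h : Consecutive w x y) :
    Consecutive (w.map Pass.mirror) x.mirror y.mirror := by
  obtain ⟨u, hu⟩ := h
  exact ⟨u.map Pass.mirror, hu.map _⟩

theorem MatchedPair.mirror {a b : ℕ} (h : MatchedPair w a b) :
    MatchedPair (w.map Pass.mirror) a b := by
  obtain ⟨hab, o, s, h₁, h₂⟩ := h
  exact ⟨hab, !o, !s, h₁.mirror, h₂.mirror⟩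

namespace KnotDiagram

variable {D : KnotDiagram}

theorem IsMatched.mirror (h : D.IsMatched) : D.mirror.IsMatched := by
  obtain ⟨m, hm⟩ := h
  exact ⟨m, List.forall_mem_map.2 fun x hx => ⟨(hm x hx).1, (hm x hx).2.mirror⟩⟩

theorem IsBipartite.mirror (h : D.IsBipartite) : D.mirror.IsBipartite := by
  obtain ⟨E, hE, hM⟩ := h
  exact ⟨E.mirror, hE.mirror, hM.mirror⟩

theorem isBipartite_mirror_iff : D.mirror.IsBipartite ↔ D.IsBipartite :=
  ⟨fun h => by simpa only [mirror_mirror] using h.mirror, IsBipartite.mirror⟩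

end KnotDiagram

end Mirror

theorem mainTheorem2 (K : KnotDiagram)
    (hK : K ∈ [knot9_35, knot9_37, knot9_41, knot9_46, pretzel33neg3, knot9_47, knot9_48, knot9_49,
      knot10_74, knot10_75, knot10_103, knot10_155, knot10_157]) :
    ¬ K.IsBipartite ∧ ¬ K.mirror.IsBipartite := by
  rw [isBipartite_mirror_iff, and_self]
  simp only [List.mem_cons, List.not_mem_nil, or_false] at hK
  rcases hK with rfl | rfl | rfl | rfl | rfl | rfl | rfl | rfl | rfl | rfl | rfl | rfl | rfl
  · exact knot9_35_not_isBipartite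
  · exact knot9_37_not_isBipartite
  · exact knot9_41_not_isBipartite
  · exact knot9_46_not_isBipartite
  · exact pretzel33neg3_not_isBipartite
  · exact knot9_47_not_isBipartite
  · exact knot9_48_not_isBipartite
  · exact knot9_49_not_isBipartite
  · exact knot10_74_not_isBipartite
  · exact knot10_75_not_isBipartite
  · exact knot10_103_not_isBipartite
  · exact knot10_155_not_isBipartite
  · exact knot10_157_not_isBipartite
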